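/- Let $(\mathcal M,\mathfrak g)$ be a smooth finite-dimensional Riemannian manifold (Hausdorff, second countable, without boundary) that is geodesically complete, so that $\mathrm{Exp}_x$ is defined on all of $T_x\mathcal M$. For $v\in T_x\mathcal M$ and $y=\mathrm{Exp}_x(v)$, let $\Gamma_x^y:T_x\mathcal M\to T_y\mathcal M$ be the Levi-Civita parallel transport along the geodesic $t\mapsto \mathrm{Exp}_x(tv)$, $0\le t\le 1$, and $\Gamma_y^x$ its inverse (if any two points of $\mathcal M$ are joined by a unique geodesic, these depend only on $x,y$, and $v=\mathrm{Exp}_x^{-1}(y)$). Let $n\ge 1$, $L>0$, and let $f_1,\dots,f_n:\mathcal M\to\mathbb R$ be $L$-g-smooth: each $f_i$ is differentiable and its Riemannian gradient satisfies $\|\nabla f_i(x)-\Gamma_y^x\nabla f_i(y)\|\le L\|v\|$ for all $x\in\mathcal M$, $v\in T_x\mathcal M$, $y=\mathrm{Exp}_x(v)$. Put $f=\frac1n\sum_{i=1}^n f_i$ and let $f^*\in\mathbb R$ satisfy $f(x)\ge f^*$ for all $x\in\mathcal M$. Let $\omega\ge 0$ and let $\mathcal Q_1,\dots,\mathcal Q_n$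 be unbiased compressors with conic variance $\omega$, that is, random mappings $T_x\mathcal M\to T_x\mathcal M$ (for every $x\in\mathcal M$) with $\mathbb E[\mathcal Q_i(y)]=y$ and $\mathbb E\|\mathcal Q_i(y)-y\|^2\le\omega\|y\|^2$ for all $x\in\mathcal M$, $y\in T_x\mathcal M$. Let $p\in(0,1]$ and $$0<\eta\le\frac{1}{L\left(1+\sqrt{\frac{1-p}{p}\,\frac{\omega}{n}}\right)}.$$ Consider the Riemannian MARINA iteration: start from $x^0\in\mathcal M$ and $g_1^0,\dots,g_n^0\in T_{x^0}\mathcal M$ with $\frac1n\sum_i g_i^0=\nabla f(x^0)$ (for instance $g_i^0=\nabla f_i(x^0)$); for $k=0,1,\dots$ put $g^k=\frac1n\sum_{i=1}^n g_i^k$, $x^{k+1}=\mathrm{Exp}_{x^k}(-\eta g^k)$ and, for all $i$, $$g_i^{k+1}=\begin{cases}\nabla f_i(x^{k+1}) & \text{if } c^k=1,\\ \Gamma_{x^k}^{x^{k+1}}g_i^k+\mathcal Q_i^k\left(\nabla f_i(x^{k+1})-\Gamma_{x^k}^{x^{k+1}}\nabla f_i(x^k)\right) & \text{if } c^k=0,\end{cases}$$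 where $\Gamma_{x^k}^{x^{k+1}}$ is the transport along $t\mapsto\mathrm{Exp}_{x^k}(-t\eta g^k)$, the coin $c^k$, common to all workers, is $1$ with probability $p$ and $0$ with probability $1-p$, $\mathcal Q_i^k$ is a fresh sample of $\mathcal Q_i$, and all the $c^k$ and $\mathcal Q_i^k$ are independent. Then for every $K\ge 1$, if $\widehat x^K$ is chosen uniformly at random from $x^0,\dots,x^{K-1}$ (independently of the run), $$\mathbb E\left[\|\nabla f(\widehat x^K)\|^2\right]\le\frac{2\,(f(x^0)-f^*)}{\eta K}.$$ -/

import Mathlib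

open Bundle Manifold MeasureTheory ProbabilityTheory
open scoped ContDiff

namespace RMarina

noncomputable section

variable {E : Type*} [NormedAddCommGroup E] [NormedSpace ℝ E]
  {M : Type*} [TopologicalSpace M] [ChartedSpace E M]

/-! ### Levi-Civita parallel transport, geodesics and the exponential map -/

/-- The velocity `γ'(t)`, a tangent vector at `γ t`. -/
def velocity (γ : ℝ → M) (t : ℝ) : TangentSpace 𝓘(ℝ, E) (γ t) :=
  mfderiv 𝓘(ℝ, ℝ) 𝓘(ℝ, E) γ t (1 : ℝ)

/-- The coordinates, in the chart around `x₀`, of a vector field `V` along the curve `γ`. -/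
def coordField (x₀ : M) (γ : ℝ → M) (V : ∀ t, TangentSpace 𝓘(ℝ, E) (γ t)) (t : ℝ) : E :=
  mfderiv 𝓘(ℝ, E) 𝓘(ℝ, E) (extChartAt 𝓘(ℝ, E) x₀) (γ t) (V t)

section Riemannian

variable [RiemannianBundle (fun x : M => TangentSpace 𝓘(ℝ, E) x)]

/-- The Riemannian metric in the chart around `x₀`: the bilinear form `G(y)(u, v)` on `E`,
for `y` in the target of the chart. -/
def coordMetric (x₀ : M) (y u v : E) : ℝ :=
  inner ℝ
    (mfderiv 𝓘(ℝ, E) 𝓘(ℝ, E) (extChartAt 𝓘(ℝ, E) x₀).symm y u :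
      TangentSpace 𝓘(ℝ, E) ((extChartAt 𝓘(ℝ, E) x₀).symm y))
    (mfderiv 𝓘(ℝ, E) 𝓘(ℝ, E) (extChartAt 𝓘(ℝ, E) x₀).symm y v)

/-- Christoffel symbols of the first kind of the Levi-Civita connection in the chart around `x₀`,
`Γ(u, v; z) = (D_u G(v, z) + D_v G(u, z) - D_z G(u, v)) / 2`. -/
def christoffel (x₀ : M) (y u v z : E) : ℝ :=
  (fderiv ℝ (fun y' => coordMetric x₀ y' v z) y u
    + fderiv ℝ (fun y' => coordMetric x₀ y' u z) y v
    - fderiv ℝ (fun y' => coordMetric x₀ y' u v) y z) / 2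

/-- The vector field `V` along the curve `γ` is parallel for the Levi-Civita connection.
In every chart, with `c` the coordinate curve and `V̂` the coordinates of `V`, this is the equation
`V̂' + Γ(c', V̂) = 0`, here paired through the metric with an arbitrary vector `z`. -/
def IsParallel (γ : ℝ → M) (V : ∀ t, TangentSpace 𝓘(ℝ, E) (γ t)) : Prop :=
  ∀ (x₀ : M) (t : ℝ), γ t ∈ (chartAt E x₀).source →
    DifferentiableAt ℝ (coordField x₀ γ V) t ∧
    ∀ z : E,
      coordMetric x₀ (extChartAt 𝓘(ℝ, E) x₀ (γ t)) (deriv (coordField x₀ γ V) t) z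
        + christoffel x₀ (extChartAt 𝓘(ℝ, E) x₀ (γ t))
            (coordField x₀ γ (velocity γ) t) (coordField x₀ γ V t) z = 0

/-- Parallel transport `T_{γ(a)} M → T_{γ(b)} M` along the curve `γ`. -/
def parallelTransport (γ : ℝ → M) (a b : ℝ) (w : TangentSpace 𝓘(ℝ, E) (γ a)) :
    TangentSpace 𝓘(ℝ, E) (γ b) :=
  open Classical in
  if h : ∃ V : ∀ t, TangentSpace 𝓘(ℝ, E) (γ t), IsParallel γ V ∧ V a = w
  then h.choose b else 0

/-- Geodesics: smooth curves with parallel velocity. -/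
structure IsGeodesic (γ : ℝ → M) : Prop where
  contMDiff : ContMDiff 𝓘(ℝ, ℝ) 𝓘(ℝ, E) ∞ γ
  parallel_velocity : IsParallel γ (velocity (E := E) γ)

/-- `γ` is a geodesic with `γ(0) = x` and `γ'(0) = v`. -/
def IsGeodesicFrom (x : M) (v : TangentSpace 𝓘(ℝ, E) x) (γ : ℝ → M) : Prop :=
  IsGeodesic (E := E) γ ∧ (⟨γ 0, velocity γ 0⟩ : TangentBundle 𝓘(ℝ, E) M) = ⟨x, v⟩

variable (E M) in
/-- Geodesic completeness: the exponential map is defined on the whole tangent bundle. -/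
def GeodesicallyComplete : Prop :=
  ∀ (x : M) (v : TangentSpace 𝓘(ℝ, E) x), ∃ γ : ℝ → M, IsGeodesicFrom x v γ

/-- The geodesic issued from `x` with initial velocity `v`. -/
def geod (x : M) (v : TangentSpace 𝓘(ℝ, E) x) : ℝ → M :=
  open Classical in
  if h : ∃ γ : ℝ → M, IsGeodesicFrom x v γ then h.choose else fun _ => x

theorem geod_zero (x : M) (v : TangentSpace 𝓘(ℝ, E) x) : geod x v 0 = x := by
  unfold geod
  split_ifs with h
  · exact congrArg TotalSpace.proj h.choose_spec.2
  · rfl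

/-- The exponential map `Exp_x(v)`. -/
def riemExp (x : M) (v : TangentSpace 𝓘(ℝ, E) x) : M := geod x v 1

/-- Parallel transport `T_x M → T_{Exp_x(v)} M` along the geodesic `t ↦ Exp_x(t v)`, `0 ≤ t ≤ 1`. -/
def expTransport (x : M) (v w : TangentSpace 𝓘(ℝ, E) x) : TangentSpace 𝓘(ℝ, E) (riemExp x v) :=
  parallelTransport (geod x v) 0 1 ((geod_zero x v).symm ▸ w)

/-! ### Gradients and geodesic smoothness -/

/-- The Riemannian gradient: the vector representing the differential `df_x`. -/
def riemGrad [FiniteDimensional ℝ E] (f : M → ℝ) (x : M) : TangentSpace 𝓘(ℝ, E) x :=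
  haveI : FiniteDimensional ℝ (TangentSpace 𝓘(ℝ, E) x) := inferInstanceAs (FiniteDimensional ℝ E)
  haveI : CompleteSpace (TangentSpace 𝓘(ℝ, E) x) := FiniteDimensional.complete ℝ _
  (InnerProductSpace.toDual ℝ (TangentSpace 𝓘(ℝ, E) x)).symm (mfderiv 𝓘(ℝ, E) 𝓘(ℝ, ℝ) f x)

variable (E) in
/-- `f` is geodesically `L`-smooth: it is differentiable and its gradient is `L`-Lipschitz along
geodesics, `‖∇f(x) - Γ_y^x ∇f(y)‖ ≤ L ‖v‖` whenever `y = Exp_x(v)`, where `Γ_y^x` is the parallel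
transport along the geodesic from `x` to `y` with initial velocity `v`. -/
structure IsGSmooth [FiniteDimensional ℝ E] (L : ℝ) (f : M → ℝ) : Prop where
  mdifferentiable : MDifferentiable 𝓘(ℝ, E) 𝓘(ℝ, ℝ) f
  lipschitz : ∀ γ : ℝ → M, IsGeodesic (E := E) γ →
    ‖riemGrad (E := E) f (γ 0) - parallelTransport γ 1 0 (riemGrad f (γ 1))‖
      ≤ L * ‖velocity (E := E) γ 0‖

/-! ### Compressors -/

/-- A stochastic mapping of the tangent spaces, `Q s x : T_x M → T_x M` with `s` drawn from `ν`,
is an unbiased compressor with conic variance `ωQ`. -/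
structure IsUnbiasedCompressor {S : Type*} [MeasurableSpace S] (ν : Measure S)
    (Q : S → ∀ x : M, TangentSpace 𝓘(ℝ, E) x → TangentSpace 𝓘(ℝ, E) x) (ωQ : ℝ) : Prop where
  nonneg : 0 ≤ ωQ
  integrable : ∀ (x : M) (v : TangentSpace 𝓘(ℝ, E) x), Integrable (fun s => Q s x v) ν
  unbiased : ∀ (x : M) (v : TangentSpace 𝓘(ℝ, E) x), ∫ s, Q s x v ∂ν = v
  integrable_sq : ∀ (x : M) (v : TangentSpace 𝓘(ℝ, E) x),
    Integrable (fun s => ‖Q s x v - v‖ ^ 2) ν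
  variance_le : ∀ (x : M) (v : TangentSpace 𝓘(ℝ, E) x),
    ∫ s, ‖Q s x v - v‖ ^ 2 ∂ν ≤ ωQ * ‖v‖ ^ 2

/-! ### The algorithm -/

/-- The objective `f = (1/n) ∑ f_i`. -/
def objective {n : ℕ} (f : Fin n → M → ℝ) (x : M) : ℝ := (1 / (n : ℝ)) * ∑ i, f i x

variable (E M) in
/-- A state of the algorithm: the point `x^k` and the workers' estimators `g_i^k ∈ T_{x^k} M`. -/
structure State (n : ℕ) where
  pt : M
  est : Fin n → TangentSpace 𝓘(ℝ, E) pt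

/-- The aggregated estimator `g^k = (1/n) ∑ g_i^k`. -/
def State.avg {n : ℕ} (σ : State E M n) : TangentSpace 𝓘(ℝ, E) σ.pt :=
  (1 / (n : ℝ)) • ∑ i, σ.est i

/-- One iteration. The coin `c` is common to all workers: if it is `true`, every worker sends its
full gradient, otherwise worker `i` sends a compressed difference, with the randomness `s i`. -/
def marinaStep [FiniteDimensional ℝ E] {S : Type*} {n : ℕ} (f : Fin n → M → ℝ)
    (Q : Fin n → S → ∀ x : M, TangentSpace 𝓘(ℝ, E) x → TangentSpace 𝓘(ℝ, E) x) (η : ℝ)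
    (σ : State E M n) (c : Bool) (s : Fin n → S) : State E M n where
  pt := riemExp σ.pt (-(η • σ.avg))
  est := fun i =>
    if c then riemGrad (f i) (riemExp σ.pt (-(η • σ.avg)))
    else expTransport σ.pt (-(η • σ.avg)) (σ.est i)
      + Q i (s i) (riemExp σ.pt (-(η • σ.avg)))
          (riemGrad (f i) (riemExp σ.pt (-(η • σ.avg)))
            - expTransport σ.pt (-(η • σ.avg)) (riemGrad (f i) σ.pt))

/-- The state after `k` iterations, as a function of the random inputs `r 0, r 1, …` (a coin and
one compressor sample per worker at each iteration). -/
def marina [FiniteDimensional ℝ E] {S : Type*} {n : ℕ} (f : Fin n → M → ℝ)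
    (Q : Fin n → S → ∀ x : M, TangentSpace 𝓘(ℝ, E) x → TangentSpace 𝓘(ℝ, E) x) (η : ℝ)
    (σ₀ : State E M n) (r : ℕ → Bool × (Fin n → S)) : ℕ → State E M n
  | 0 => σ₀
  | k + 1 => marinaStep f Q η (marina f Q η σ₀ r k) (r k).1 (r k).2

end Riemannian

/-- The law of a coin that is `true` with probability `p`. -/
def coinLaw (p : ℝ) : Measure Bool :=
  ENNReal.ofReal p • Measure.dirac true + ENNReal.ofReal (1 - p) • Measure.dirac false

end

end RMarina

/-!
The Lyapunov function is `Φ(x, g) = f(x) - f* + η / (2p) ‖g - ∇f(x)‖²`. Along a geodesic, parallel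
transport is isometric, so `g`-smoothness gives the Euclidean descent inequality
`f(Exp_x(-ηg)) ≤ f(x) - η/2 (‖∇f(x)‖² + ‖g‖² - ‖g - ∇f(x)‖²) + Lη²/2 ‖g‖²`. The coin resets the
error `g - ∇f` to zero with probability `p`; otherwise the error is the transported old one plus an
average of `n` independent centred compression errors, whose variances add up to at most
`ω/n (Lη)² ‖g‖²`. The step size is such that this is absorbed by the `-‖g‖²` of the descent, whence
`𝔼 Φ(x^{k+1}, g^{k+1}) + η/2 ‖∇f(x^k)‖² ≤ Φ(x^k, g^k)`, and the bound follows by telescoping.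
-/

namespace RMarina

noncomputable section

section LinearODE

open Metric Set Topology
open scoped NNReal

variable {E : Type*} [NormedAddCommGroup E] [NormedSpace ℝ E]

theorem isPicardLindelof_clm_apply {A : ℝ → E →L[ℝ] E} {a b : ℝ} (t₁ : Icc a b) {C : ℝ≥0}
    (hA : ContinuousOn A (Icc a b)) (hAC : ∀ t ∈ Icc a b, ‖A t‖ ≤ C) (hC : C * (b - a) ≤ 1 / 2)
    (w : E) :
    IsPicardLindelof (fun t v => A t v) t₁ w ‖w‖₊ 0 (C * (2 * ‖w‖₊)) C where
  lipschitzOnWith t ht := ((A t).lipschitz.weaken (mod_cast hAC t ht)).lipschitzOnWith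
  continuousOn v _ := hA.clm_apply continuousOn_const
  norm_le t ht v hv := by
    have hvw : ‖v‖ ≤ 2 * ‖w‖ := by
      linarith [norm_le_norm_add_norm_sub w v, mem_closedBall_iff_norm'.1 hv, coe_nnnorm w]
    calc ‖A t v‖ ≤ ‖A t‖ * ‖v‖ := (A t).le_opNorm v
      _ ≤ C * (2 * ‖w‖) := by gcongr; exact hAC t ht
  mul_max_le := by
    have hlen : max (b - t₁) (t₁ - a) ≤ b - a :=
      max_le (by linarith [t₁.2.1]) (by linarith [t₁.2.2])
    push_cast
    calc C * (2 * ‖w‖) * max (b - t₁) (t₁ - a) ≤ C * (2 * ‖w‖) * (b - a) := by gcongr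
      _ = C * (b - a) * (2 * ‖w‖) := by ring
      _ ≤ 1 / 2 * (2 * ‖w‖) := by gcongr
      _ = ‖w‖ - 0 := by ring

theorem exists_ball_forall_hasDerivAt_clm_apply [CompleteSpace E] {A : ℝ → E →L[ℝ] E} {t₀ : ℝ}
    {U : Set ℝ} (hU : U ∈ 𝓝 t₀) (hA : ContinuousOn A U) :
    ∃ ε > 0, ball t₀ ε ⊆ U ∧ ∀ t₁ ∈ ball t₀ ε, ∀ w : E, ∃ α : ℝ → E, α t₁ = w ∧
      ∀ t ∈ ball t₀ ε, HasDerivAt α (A t (α t)) t := by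
  set C : ℝ≥0 := ‖A t₀‖₊ + 1
  have hbound : ∀ᶠ t in 𝓝 t₀, ‖A t‖ < C :=
    (hA.continuousAt hU).norm.eventually_lt_const (by simp [C])
  obtain ⟨δ, hδ, hδU⟩ := Metric.nhds_basis_closedBall.mem_iff.1 (Filter.inter_mem hU hbound)
  refine ⟨min δ (1 / (4 * C)), by positivity, fun t ht => (hδU ?_).1, fun t₁ ht₁ w => ?_⟩
  · exact ball_subset_closedBall (ball_subset_ball (min_le_left _ _) ht)
  set ε := min δ (1 / (4 * (C : ℝ)))
  have hIcc : Icc (t₀ - ε) (t₀ + ε) ⊆ U ∩ {t | ‖A t‖ < C} := by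
    rw [← Real.closedBall_eq_Icc]
    exact (closedBall_subset_closedBall (min_le_left _ _)).trans hδU
  have hlen : C * ((t₀ + ε) - (t₀ - ε)) ≤ 1 / 2 := by
    have hε : ε * (4 * C) ≤ 1 := (le_div_iff₀ (by positivity)).1 (min_le_right _ _)
    linarith
  rw [Real.ball_eq_Ioo] at ht₁ ⊢
  obtain ⟨α, hα₁, hα⟩ := (isPicardLindelof_clm_apply ⟨t₁, Ioo_subset_Icc_self ht₁⟩
    (hA.mono fun t ht => (hIcc ht).1) (fun t ht => (hIcc ht).2.le) hlen
    w).exists_eq_forall_mem_Icc_hasDerivWithinAt₀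
  exact ⟨α, hα₁, fun t ht => (hα t (Ioo_subset_Icc_self ht)).hasDerivAt (Icc_mem_nhds ht.1 ht.2)⟩

end LinearODE

section BilinearForms

open Topology Filter

variable {E : Type*} [NormedAddCommGroup E] [NormedSpace ℝ E] {G : E → E →L[ℝ] E →L[ℝ] ℝ} {y : E}

/-- The Christoffel symbols of the first kind of a field `G` of bilinear forms on a normed space,
with first argument `u`: the coordinate expression of the Levi-Civita connection when `G` is the
metric in a chart. -/
def christoffelForm (G : E → E →L[ℝ] E →L[ℝ] ℝ) (y u : E) : E →L[ℝ] E →L[ℝ] ℝ :=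
  (1 / 2 : ℝ) • (fderiv ℝ G y u + (fderiv ℝ G y).flip u - ((fderiv ℝ G y).flip u).flip)

theorem christoffelForm_apply (G : E → E →L[ℝ] E →L[ℝ] ℝ) (y u v z : E) :
    christoffelForm G y u v z
      = (fderiv ℝ G y u v z + fderiv ℝ G y v u z - fderiv ℝ G y z u v) / 2 :=
  one_div_mul_eq_div 2 _

set_option synthInstance.maxHeartbeats 200000 in
-- slow instance search on nested spaces of continuous linear maps
theorem christoffelForm_smul (G : E → E →L[ℝ] E →L[ℝ] ℝ) (y u v z : E) (a : ℝ) :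
    christoffelForm G y (a • u) v z = a * christoffelForm G y u v z := by
  simp only [christoffelForm_apply, map_smul, smul_apply, smul_eq_mul]
  ring

theorem fderiv_bilin_apply (hG : DifferentiableAt ℝ G y) (u v w : E) :
    fderiv ℝ (fun y' => G y' v w) y u = fderiv ℝ G y u v w := by
  rw [((hG.hasFDerivAt.clm_apply (hasFDerivAt_const v y)).clm_apply (hasFDerivAt_const w y)).fderiv]
  simp

theorem fderiv_bilin_symm (hG : DifferentiableAt ℝ G y) (hsymm : ∀ᶠ y' in 𝓝 y, ∀ v w,
    G y' v w = G y' w v) (u v w : E) :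
    fderiv ℝ G y u v w = fderiv ℝ G y u w v := by
  rw [← fderiv_bilin_apply hG, ← fderiv_bilin_apply hG]
  exact congrArg (fun D : E →L[ℝ] ℝ => D u) (EventuallyEq.fderiv_eq (hsymm.mono fun y' h => h v w))

theorem christoffelForm_add_swap (hsymm : ∀ u v w, fderiv ℝ G y u v w = fderiv ℝ G y u w v)
    (u v w : E) :
    christoffelForm G y u v w + christoffelForm G y u w v = fderiv ℝ G y u v w := by
  rw [christoffelForm_apply, christoffelForm_apply, hsymm u w v, hsymm w u v, hsymm v u w]
  ring

set_option synthInstance.maxHeartbeats 200000 in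
-- slow instance search on nested spaces of continuous linear maps
theorem fderiv_bilin_pullback {F : Type*} [NormedAddCommGroup F] [NormedSpace ℝ F]
    {H : F → F →L[ℝ] F →L[ℝ] ℝ} {φ : E → F}
    (hH : DifferentiableAt ℝ H (φ y)) (hφ : DifferentiableAt ℝ φ y)
    (hφ' : DifferentiableAt ℝ (fderiv ℝ φ) y) (a b c : E) :
    fderiv ℝ (fun y' => H (φ y') (fderiv ℝ φ y' b) (fderiv ℝ φ y' c)) y a
      = fderiv ℝ H (φ y) (fderiv ℝ φ y a) (fderiv ℝ φ y b) (fderiv ℝ φ y c)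
        + H (φ y) (fderiv ℝ (fderiv ℝ φ) y a b) (fderiv ℝ φ y c)
        + H (φ y) (fderiv ℝ φ y b) (fderiv ℝ (fderiv ℝ φ) y a c) := by
  have hHφ : HasFDerivAt (fun y' => H (φ y')) ((fderiv ℝ H (φ y)).comp (fderiv ℝ φ y)) y :=
    HasFDerivAt.comp (g := H) (g' := fderiv ℝ H (φ y)) y hH.hasFDerivAt hφ.hasFDerivAt
  rw [((hHφ.clm_apply (hφ'.hasFDerivAt.clm_apply (hasFDerivAt_const b y))).clm_apply
    (hφ'.hasFDerivAt.clm_apply (hasFDerivAt_const c y))).fderiv]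
  simp
  ring

theorem christoffelForm_pullback {F : Type*} [NormedAddCommGroup F] [NormedSpace ℝ F]
    {H : F → F →L[ℝ] F →L[ℝ] ℝ} {φ : E → F}
    (hφ : ContDiffAt ℝ 2 φ y) (hG : DifferentiableAt ℝ G y) (hH : DifferentiableAt ℝ H (φ y))
    (hsymm : ∀ v w, H (φ y) v w = H (φ y) w v)
    (hGH : ∀ᶠ y' in 𝓝 y, ∀ u v, G y' u v = H (φ y') (fderiv ℝ φ y' u) (fderiv ℝ φ y' v))
    (u v z : E) :
    christoffelForm G y u v z
      = christoffelForm H (φ y) (fderiv ℝ φ y u) (fderiv ℝ φ y v) (fderiv ℝ φ y z)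
        + H (φ y) (fderiv ℝ (fderiv ℝ φ) y u v) (fderiv ℝ φ y z) := by
  have hφ' : DifferentiableAt ℝ (fderiv ℝ φ) y :=
    (hφ.fderiv_right (m := 1) (by norm_num)).differentiableAt (by norm_num)
  have hφsymm (a b : E) : fderiv ℝ (fderiv ℝ φ) y a b = fderiv ℝ (fderiv ℝ φ) y b a :=
    (hφ.isSymmSndFDerivAt (by simp)) a b
  have hderiv (a b c : E) : fderiv ℝ G y a b c
      = fderiv ℝ H (φ y) (fderiv ℝ φ y a) (fderiv ℝ φ y b) (fderiv ℝ φ y c)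
        + H (φ y) (fderiv ℝ (fderiv ℝ φ) y a b) (fderiv ℝ φ y c)
        + H (φ y) (fderiv ℝ φ y b) (fderiv ℝ (fderiv ℝ φ) y a c) := by
    rw [← fderiv_bilin_apply hG, EventuallyEq.fderiv_eq (hGH.mono fun y' h => h b c),
      fderiv_bilin_pullback hH (hφ.differentiableAt (by norm_num)) hφ']
  rw [christoffelForm_apply, christoffelForm_apply, hderiv, hderiv, hderiv, hφsymm v u,
    hφsymm z u, hφsymm z v, hsymm (fderiv ℝ φ y v) (fderiv ℝ (fderiv ℝ φ) y u z),
    hsymm (fderiv ℝ φ y u) (fderiv ℝ (fderiv ℝ φ) y v z)]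
  ring

set_option synthInstance.maxHeartbeats 200000 in
-- slow instance search on nested spaces of continuous linear maps
theorem hasDerivAt_bilin_apply {c v w : ℝ → E} {c' v' w' : E} {t : ℝ}
    (hG : DifferentiableAt ℝ G (c t)) (hc : HasDerivAt c c' t) (hv : HasDerivAt v v' t)
    (hw : HasDerivAt w w' t) :
    HasDerivAt (fun s => G (c s) (v s) (w s))
      (fderiv ℝ G (c t) c' (v t) (w t) + G (c t) v' (w t) + G (c t) (v t) w') t :=
  ((HasFDerivAt.comp_hasDerivAt (l := G) t hG.hasFDerivAt hc).clm_apply hv).clm_apply hw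

set_option synthInstance.maxHeartbeats 200000 in
-- slow instance search on nested spaces of continuous linear maps
set_option maxSynthPendingDepth 3 in
theorem continuousOn_christoffelForm {c u : ℝ → E} {s : Set ℝ}
    (hG : ∀ t ∈ s, ContDiffAt ℝ 1 G (c t)) (hc : ContinuousOn c s) (hu : ContinuousOn u s) :
    ContinuousOn (fun t => christoffelForm G (c t) (u t)) s := by
  have hderiv : ContinuousOn (fun t => fderiv ℝ G (c t)) s := fun t ht =>
    ContinuousAt.comp_continuousWithinAt (g := fderiv ℝ G)
      ((hG t ht).continuousAt_fderiv one_ne_zero) (hc t ht)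
  have hflip : ContinuousOn (fun t => (fderiv ℝ G (c t)).flip (u t)) s :=
    ((ContinuousLinearMap.flipₗᵢ ℝ E E (E →L[ℝ] ℝ)).continuous.comp_continuousOn
      hderiv).clm_apply hu
  exact (((hderiv.clm_apply hu).add hflip).sub
    ((ContinuousLinearMap.flipₗᵢ ℝ E E ℝ).continuous.comp_continuousOn hflip)).const_smul
      (1 / 2 : ℝ)

theorem continuousAt_inverse_clm {F : Type*} [NormedAddCommGroup F] [NormedSpace ℝ F]
    [CompleteSpace E] {A : E →L[ℝ] F} (hA : A.IsInvertible) :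
    ContinuousAt (ContinuousLinearMap.inverse : (E →L[ℝ] F) → F →L[ℝ] E) A := by
  obtain ⟨e, rfl⟩ := hA
  exact (contDiffAt_map_inverse (n := 0) e).continuousAt

end BilinearForms

section Charts

open Topology Set

variable {E : Type*} [NormedAddCommGroup E] [NormedSpace ℝ E]
  {M : Type*} [TopologicalSpace M] [ChartedSpace E M] {x₀ x₁ x : M} {y : E}

theorem extChartAt_mem_target (hx : x ∈ (chartAt E x₀).source) :
    extChartAt 𝓘(ℝ, E) x₀ x ∈ (extChartAt 𝓘(ℝ, E) x₀).target :=
  (extChartAt 𝓘(ℝ, E) x₀).map_source (by rwa [extChartAt_source])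

theorem extChartAt_symm_extChartAt (hx : x ∈ (chartAt E x₀).source) :
    (extChartAt 𝓘(ℝ, E) x₀).symm (extChartAt 𝓘(ℝ, E) x₀ x) = x :=
  (extChartAt 𝓘(ℝ, E) x₀).left_inv (by rwa [extChartAt_source])

/-- The change of coordinates from the chart around `x₀` to the chart around `x₁`. -/
def chartTransition (x₀ x₁ : M) : PartialEquiv E E :=
  (extChartAt 𝓘(ℝ, E) x₀).symm ≫ extChartAt 𝓘(ℝ, E) x₁

theorem mem_chartTransition_source :
    y ∈ (chartTransition x₀ x₁ : PartialEquiv E E).source ↔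
      y ∈ (extChartAt 𝓘(ℝ, E) x₀).target ∧
        (extChartAt 𝓘(ℝ, E) x₀).symm y ∈ (chartAt E x₁).source := by
  rw [chartTransition, PartialEquiv.trans_source, PartialEquiv.symm_source, extChartAt_source]
  rfl

theorem extChartAt_mem_chartTransition_source (hx₀ : x ∈ (chartAt E x₀).source)
    (hx₁ : x ∈ (chartAt E x₁).source) :
    extChartAt 𝓘(ℝ, E) x₀ x ∈ (chartTransition x₀ x₁ : PartialEquiv E E).source :=
  mem_chartTransition_source.2
    ⟨extChartAt_mem_target hx₀, by rwa [extChartAt_symm_extChartAt hx₀]⟩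

theorem chartTransition_extChartAt (x₁ : M) (hx : x ∈ (chartAt E x₀).source) :
    chartTransition x₀ x₁ (extChartAt 𝓘(ℝ, E) x₀ x) = extChartAt 𝓘(ℝ, E) x₁ x :=
  congrArg (extChartAt 𝓘(ℝ, E) x₁) (extChartAt_symm_extChartAt hx)

theorem isOpen_chartTransition_source (x₀ x₁ : M) :
    IsOpen (chartTransition x₀ x₁ : PartialEquiv E E).source :=
  (continuousOn_extChartAt_symm x₀).isOpen_inter_preimage (isOpen_extChartAt_target x₀)
    (isOpen_extChartAt_source x₁)

theorem contDiffAt_chartTransition {n : ℕ∞ω} [IsManifold 𝓘(ℝ, E) n M]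
    (hy : y ∈ (chartTransition x₀ x₁ : PartialEquiv E E).source) :
    ContDiffAt ℝ n (chartTransition x₀ x₁) y := by
  have h := contDiffWithinAt_ext_coord_change (I := 𝓘(ℝ, E)) (n := n) x₁ x₀ hy
  rwa [modelWithCornersSelf_coe, range_id, contDiffWithinAt_univ] at h

theorem contDiffAt_extChartAt_comp {n : ℕ∞ω} [IsManifold 𝓘(ℝ, E) n M] {γ : ℝ → M} {t : ℝ}
    (hγ : ContMDiffAt 𝓘(ℝ, ℝ) 𝓘(ℝ, E) n γ t) (hx₀ : γ t ∈ (chartAt E x₀).source) :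
    ContDiffAt ℝ n (fun s => extChartAt 𝓘(ℝ, E) x₀ (γ s)) t :=
  ((contMDiffAt_extChartAt' (I := 𝓘(ℝ, E)) hx₀).comp t hγ).contDiffAt

theorem contMDiffOn_mfderiv_extChartAt_symm [IsManifold 𝓘(ℝ, E) ∞ M] (x₀ : M)
    (w : E) :
    ContMDiffOn 𝓘(ℝ, E) 𝓘(ℝ, E).tangent ∞
      (fun y => (⟨(extChartAt 𝓘(ℝ, E) x₀).symm y,
        mfderiv 𝓘(ℝ, E) 𝓘(ℝ, E) (extChartAt 𝓘(ℝ, E) x₀).symm y w⟩ : TangentBundle 𝓘(ℝ, E) M))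
      (extChartAt 𝓘(ℝ, E) x₀).target := by
  have hopen : IsOpen (extChartAt 𝓘(ℝ, E) x₀).target := isOpen_extChartAt_target x₀
  have htangent := (contMDiffOn_extChartAt_symm (I := 𝓘(ℝ, E)) (n := ∞) x₀)
    |>.contMDiffOn_tangentMapWithin (m := ∞) (by simp) hopen.uniqueMDiffOn
  have hconst : ContMDiffOn 𝓘(ℝ, E) 𝓘(ℝ, E).tangent ∞
      (fun y : E => (⟨y, w⟩ : TangentBundle 𝓘(ℝ, E) E)) (extChartAt 𝓘(ℝ, E) x₀).target :=
    contMDiffOn_vectorSpace_iff_contDiffOn.2 contDiffOn_const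
  refine (htangent.comp hconst fun y hy => hy).congr fun y hy => ?_
  simp only [Function.comp, tangentMapWithin, mfderivWithin_of_isOpen hopen hy]

variable [IsManifold 𝓘(ℝ, E) 1 M]

theorem mdifferentiableAt_extChartAt_symm (hy : y ∈ (extChartAt 𝓘(ℝ, E) x₀).target) :
    MDifferentiableAt 𝓘(ℝ, E) 𝓘(ℝ, E) (extChartAt 𝓘(ℝ, E) x₀).symm y :=
  (mdifferentiableOn_extChartAt_symm (I := 𝓘(ℝ, E))).mdifferentiableAt
    ((isOpen_extChartAt_target x₀).mem_nhds hy)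

theorem injective_mfderiv_extChartAt_symm (hy : y ∈ (extChartAt 𝓘(ℝ, E) x₀).target) :
    Function.Injective (mfderiv 𝓘(ℝ, E) 𝓘(ℝ, E) (extChartAt 𝓘(ℝ, E) x₀).symm y) := by
  have h := isInvertible_mfderivWithin_extChartAt_symm (I := 𝓘(ℝ, E)) hy
  rw [modelWithCornersSelf_coe, range_id, mfderivWithin_univ] at h
  exact h.injective

theorem mfderiv_extChartAt_symm_mfderiv_extChartAt (hy : y ∈ (extChartAt 𝓘(ℝ, E) x₀).target)
    (v : TangentSpace 𝓘(ℝ, E) ((extChartAt 𝓘(ℝ, E) x₀).symm y)) :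
    mfderiv 𝓘(ℝ, E) 𝓘(ℝ, E) (extChartAt 𝓘(ℝ, E) x₀).symm y
      (mfderiv 𝓘(ℝ, E) 𝓘(ℝ, E) (extChartAt 𝓘(ℝ, E) x₀) ((extChartAt 𝓘(ℝ, E) x₀).symm y) v) = v := by
  have h := mfderivWithin_extChartAt_symm_comp_mfderiv_extChartAt (I := 𝓘(ℝ, E)) hy
  rw [modelWithCornersSelf_coe, range_id, mfderivWithin_univ] at h
  exact congrArg (fun A => A v) h

theorem fderiv_chartTransition (hy : y ∈ (chartTransition x₀ x₁ : PartialEquiv E E).source)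
    (v : E) :
    fderiv ℝ (chartTransition x₀ x₁) y v
      = mfderiv 𝓘(ℝ, E) 𝓘(ℝ, E) (extChartAt 𝓘(ℝ, E) x₁) ((extChartAt 𝓘(ℝ, E) x₀).symm y)
          (mfderiv 𝓘(ℝ, E) 𝓘(ℝ, E) (extChartAt 𝓘(ℝ, E) x₀).symm y v) := by
  obtain ⟨hy₀, hy₁⟩ := mem_chartTransition_source.1 hy
  have h := mfderiv_comp y (mdifferentiableAt_extChartAt hy₁)
    (mdifferentiableAt_extChartAt_symm hy₀)
  rw [← mfderiv_eq_fderiv]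
  exact congrArg (fun A => A v) h

theorem fderiv_chartTransition_mfderiv_extChartAt (hx₀ : x ∈ (chartAt E x₀).source)
    (hx₁ : x ∈ (chartAt E x₁).source) (v : TangentSpace 𝓘(ℝ, E) x) :
    fderiv ℝ (chartTransition x₀ x₁) (extChartAt 𝓘(ℝ, E) x₀ x)
        (mfderiv 𝓘(ℝ, E) 𝓘(ℝ, E) (extChartAt 𝓘(ℝ, E) x₀) x v)
      = mfderiv 𝓘(ℝ, E) 𝓘(ℝ, E) (extChartAt 𝓘(ℝ, E) x₁) x v := by
  have hτ := (contDiffAt_chartTransition (n := 1)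
    (extChartAt_mem_chartTransition_source hx₀ hx₁)).differentiableAt one_ne_zero
  have hcomp : chartTransition x₀ x₁ ∘ extChartAt 𝓘(ℝ, E) x₀ =ᶠ[𝓝 x] extChartAt 𝓘(ℝ, E) x₁ :=
    ((chartAt E x₀).open_source.eventually_mem hx₀).mono fun x' => chartTransition_extChartAt x₁
  have h := mfderiv_comp x hτ.mdifferentiableAt (mdifferentiableAt_extChartAt hx₀)
  rw [hcomp.mfderiv_eq, mfderiv_eq_fderiv] at h
  exact (congrArg (fun A => A v) h).symm

theorem hasDerivAt_extChartAt_comp {γ : ℝ → M} {t : ℝ}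
    (hγ : MDifferentiableAt 𝓘(ℝ, ℝ) 𝓘(ℝ, E) γ t) (hx₀ : γ t ∈ (chartAt E x₀).source) :
    HasDerivAt (fun s => extChartAt 𝓘(ℝ, E) x₀ (γ s)) (coordField x₀ γ (velocity γ) t) t := by
  have h := (mdifferentiableAt_extChartAt (I := 𝓘(ℝ, E)) hx₀).hasMFDerivAt.comp t hγ.hasMFDerivAt
  exact hasDerivAt_iff_hasFDerivAt.2 (h.hasFDerivAt.congr_fderiv
    (ContinuousLinearMap.ext_ring (one_smul ℝ _).symm))

end Charts

section Metric

variable {E : Type*} [NormedAddCommGroup E] [NormedSpace ℝ E]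
  {M : Type*} [TopologicalSpace M] [ChartedSpace E M]
  [RiemannianBundle (fun x : M => TangentSpace 𝓘(ℝ, E) x)] {x₀ x₁ : M} {y : E}

/-- The metric `coordMetric` in the chart around `x₀`, as a field of continuous bilinear forms. -/
def metricForm (x₀ : M) (y : E) : E →L[ℝ] E →L[ℝ] ℝ :=
  let A : E →L[ℝ] TangentSpace 𝓘(ℝ, E) ((extChartAt 𝓘(ℝ, E) x₀).symm y) :=
    mfderiv 𝓘(ℝ, E) 𝓘(ℝ, E) (extChartAt 𝓘(ℝ, E) x₀).symm y
  (innerSL ℝ).bilinearComp A A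

theorem metricForm_apply (x₀ : M) (y u v : E) : metricForm x₀ y u v = coordMetric x₀ y u v := rfl

theorem metricForm_symm (x₀ : M) (y u v : E) : metricForm x₀ y u v = metricForm x₀ y v u :=
  (real_inner_comm _ _ : coordMetric x₀ y u v = coordMetric x₀ y v u)

section

variable [IsManifold 𝓘(ℝ, E) 1 M]

theorem metricForm_mfderiv_extChartAt {x : M} (hx : x ∈ (chartAt E x₀).source)
    (v w : TangentSpace 𝓘(ℝ, E) x) :
    metricForm x₀ (extChartAt 𝓘(ℝ, E) x₀ x)
      (mfderiv 𝓘(ℝ, E) 𝓘(ℝ, E) (extChartAt 𝓘(ℝ, E) x₀) x v)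
      (mfderiv 𝓘(ℝ, E) 𝓘(ℝ, E) (extChartAt 𝓘(ℝ, E) x₀) x w) = inner ℝ v w := by
  have hy := extChartAt_mem_target hx
  have hinv := extChartAt_symm_extChartAt hx
  generalize extChartAt 𝓘(ℝ, E) x₀ x = y at hy hinv
  subst hinv
  exact congrArg₂ (fun a b => inner ℝ a b) (mfderiv_extChartAt_symm_mfderiv_extChartAt hy v)
    (mfderiv_extChartAt_symm_mfderiv_extChartAt hy w)

theorem metricForm_chartTransition (hy : y ∈ (chartTransition x₀ x₁ : PartialEquiv E E).source)
    (u v : E) :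
    metricForm x₀ y u v = metricForm x₁ (chartTransition x₀ x₁ y)
      (fderiv ℝ (chartTransition x₀ x₁) y u) (fderiv ℝ (chartTransition x₀ x₁) y v) := by
  rw [fderiv_chartTransition hy, fderiv_chartTransition hy]
  exact (metricForm_mfderiv_extChartAt (mem_chartTransition_source.1 hy).2 _ _).symm

theorem metricForm_self_pos (hy : y ∈ (extChartAt 𝓘(ℝ, E) x₀).target) {u : E} (hu : u ≠ 0) :
    0 < metricForm x₀ y u u :=
  real_inner_self_pos.2 fun h =>
    hu (injective_mfderiv_extChartAt_symm hy (h.trans (map_zero _).symm))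

theorem isInvertible_metricForm [FiniteDimensional ℝ E]
    (hy : y ∈ (extChartAt 𝓘(ℝ, E) x₀).target) : (metricForm x₀ y).IsInvertible := by
  have hinj : Function.Injective (metricForm x₀ y).toLinearMap := by
    refine (injective_iff_map_eq_zero _).2 fun u hu => of_not_not fun hu₀ => ?_
    exact (metricForm_self_pos hy hu₀).ne' (congrArg (fun A : E →L[ℝ] ℝ => A u) hu)
  have hdim : Module.finrank ℝ E = Module.finrank ℝ (E →L[ℝ] ℝ) := by
    rw [← (LinearMap.toContinuousLinearMap (𝕜 := ℝ) (E := E) (F' := ℝ)).finrank_eq]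
    exact Subspace.dual_finrank_eq.symm
  exact ⟨(LinearEquiv.ofInjectiveOfFinrankEq _ hinj hdim).toContinuousLinearEquiv, rfl⟩

end

variable [IsManifold 𝓘(ℝ, E) ∞ M]
  [IsContMDiffRiemannianBundle 𝓘(ℝ, E) ∞ E (fun x : M => TangentSpace 𝓘(ℝ, E) x)]

theorem contDiffAt_metricForm [FiniteDimensional ℝ E]
    (hy : y ∈ (extChartAt 𝓘(ℝ, E) x₀).target) : ContDiffAt ℝ ∞ (metricForm (E := E) x₀) y := by
  refine ContDiffOn.contDiffAt ?_ ((isOpen_extChartAt_target x₀).mem_nhds hy)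
  refine contDiffOn_clm_apply.2 fun u => contDiffOn_clm_apply.2 fun v => ?_
  change ContDiffOn ℝ ∞ (fun y' => coordMetric x₀ y' u v) _
  rw [← contMDiffOn_iff_contDiffOn]
  exact ContMDiffOn.inner_bundle (contMDiffOn_mfderiv_extChartAt_symm x₀ u)
    (contMDiffOn_mfderiv_extChartAt_symm x₀ v)

theorem differentiableAt_metricForm [FiniteDimensional ℝ E]
    (hy : y ∈ (extChartAt 𝓘(ℝ, E) x₀).target) : DifferentiableAt ℝ (metricForm (E := E) x₀) y :=
  (contDiffAt_metricForm hy).differentiableAt (by simp)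

theorem christoffel_eq_christoffelForm [FiniteDimensional ℝ E]
    (hy : y ∈ (extChartAt 𝓘(ℝ, E) x₀).target) (u v z : E) :
    christoffel x₀ y u v z = christoffelForm (metricForm x₀) y u v z := by
  have h := differentiableAt_metricForm (E := E) hy
  rw [christoffelForm_apply, ← fderiv_bilin_apply h, ← fderiv_bilin_apply h,
    ← fderiv_bilin_apply h]
  rfl

theorem fderiv_metricForm_symm [FiniteDimensional ℝ E]
    (hy : y ∈ (extChartAt 𝓘(ℝ, E) x₀).target) (u v w : E) :
    fderiv ℝ (metricForm x₀) y u v w = fderiv ℝ (metricForm x₀) y u w v :=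
  fderiv_bilin_symm (differentiableAt_metricForm hy)
    (Filter.Eventually.of_forall fun y' => metricForm_symm x₀ y') u v w

end Metric

section ParallelFields

open Topology Filter Set

variable {E : Type*} [NormedAddCommGroup E] [NormedSpace ℝ E]
  {M : Type*} [TopologicalSpace M] [ChartedSpace E M]
  {x₀ x₁ : M} {γ : ℝ → M} {V W : ∀ t, TangentSpace 𝓘(ℝ, E) (γ t)} {t : ℝ}

theorem coordField_add (x₀ : M) (V W : ∀ t, TangentSpace 𝓘(ℝ, E) (γ t)) :
    coordField x₀ γ (fun s => V s + W s) = coordField x₀ γ V + coordField x₀ γ W :=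
  funext fun _ => map_add _ _ _

theorem coordField_const_smul (x₀ : M) (a : ℝ) (V : ∀ t, TangentSpace 𝓘(ℝ, E) (γ t)) :
    coordField x₀ γ (fun s => a • V s) = a • coordField x₀ γ V :=
  funext fun _ => map_smul _ _ _

theorem coordField_congr (x₀ : M) (hVW : ∀ᶠ s in 𝓝 t, V s = W s) :
    coordField x₀ γ V =ᶠ[𝓝 t] coordField x₀ γ W :=
  hVW.mono fun _ h => congrArg _ h

section Transition

variable [IsManifold 𝓘(ℝ, E) ∞ M]

theorem fderiv_chartTransition_coordField (V : ∀ t, TangentSpace 𝓘(ℝ, E) (γ t))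
    (h₀ : γ t ∈ (chartAt E x₀).source) (h₁ : γ t ∈ (chartAt E x₁).source) :
    fderiv ℝ (chartTransition x₀ x₁) (extChartAt 𝓘(ℝ, E) x₀ (γ t)) (coordField x₀ γ V t)
      = coordField x₁ γ V t :=
  fderiv_chartTransition_mfderiv_extChartAt h₀ h₁ (V t)

theorem surjective_fderiv_chartTransition {x : M} (h₀ : x ∈ (chartAt E x₀).source)
    (h₁ : x ∈ (chartAt E x₁).source) :
    Function.Surjective (fderiv ℝ (chartTransition x₀ x₁) (extChartAt 𝓘(ℝ, E) x₀ x)) := by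
  intro z
  have hinv : (mfderiv 𝓘(ℝ, E) 𝓘(ℝ, E) (extChartAt 𝓘(ℝ, E) x₁) x).IsInvertible :=
    isInvertible_mfderiv_extChartAt (by rwa [extChartAt_source])
  exact ⟨_, (fderiv_chartTransition_mfderiv_extChartAt h₀ h₁ _).trans (hinv.self_apply_inverse z)⟩

theorem hasDerivAt_coordField_chartTransition (hγ : MDifferentiable 𝓘(ℝ, ℝ) 𝓘(ℝ, E) γ)
    (h₀ : γ t ∈ (chartAt E x₀).source) (h₁ : γ t ∈ (chartAt E x₁).source)
    (hV : DifferentiableAt ℝ (coordField x₀ γ V) t) :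
    HasDerivAt (coordField x₁ γ V)
      (fderiv ℝ (fderiv ℝ (chartTransition x₀ x₁)) (extChartAt 𝓘(ℝ, E) x₀ (γ t))
          (coordField x₀ γ (velocity γ) t) (coordField x₀ γ V t)
        + fderiv ℝ (chartTransition x₀ x₁) (extChartAt 𝓘(ℝ, E) x₀ (γ t))
          (deriv (coordField x₀ γ V) t)) t := by
  have hτ : ContDiffAt ℝ ∞ (chartTransition x₀ x₁) (extChartAt 𝓘(ℝ, E) x₀ (γ t)) :=
    contDiffAt_chartTransition (extChartAt_mem_chartTransition_source h₀ h₁)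
  have hτ' := (hτ.fderiv_right (m := 1) (by norm_cast)).differentiableAt one_ne_zero
  have hsources : ∀ᶠ s in 𝓝 t, γ s ∈ (chartAt E x₀).source ∩ (chartAt E x₁).source :=
    (hγ t).continuousAt (((chartAt E x₀).open_source.inter (chartAt E x₁).open_source).mem_nhds
      ⟨h₀, h₁⟩)
  have hDτ := HasFDerivAt.comp_hasDerivAt (l := fderiv ℝ (chartTransition x₀ x₁)) t
    hτ'.hasFDerivAt (hasDerivAt_extChartAt_comp (hγ t) h₀)
  have hDτV := HasDerivAt.clm_apply hDτ hV.hasDerivAt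
  exact hDτV.congr_of_eventuallyEq
    (hsources.mono fun s hs => (fderiv_chartTransition_coordField V hs.1 hs.2).symm)

theorem continuousOn_coordField_velocity (hγ : ContMDiff 𝓘(ℝ, ℝ) 𝓘(ℝ, E) 1 γ) (x₀ : M) :
    ContinuousOn (coordField (E := E) x₀ γ (velocity γ)) (γ ⁻¹' (chartAt E x₀).source) := by
  intro t ht
  have hsource : ∀ᶠ s in 𝓝 t, γ s ∈ (chartAt E x₀).source :=
    hγ.continuous.continuousAt.eventually ((chartAt E x₀).open_source.eventually_mem ht)
  have hderiv : ContinuousAt (deriv fun s => extChartAt 𝓘(ℝ, E) x₀ (γ s)) t :=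
    ((contDiffAt_extChartAt_comp (hγ t) ht).continuousAt_fderiv one_ne_zero).clm_apply
      continuousAt_const
  refine (hderiv.congr (hsource.mono fun s hs => ?_)).continuousWithinAt
  exact (hasDerivAt_extChartAt_comp (hγ.mdifferentiable one_ne_zero s) hs).deriv

end Transition

section Equation

variable [RiemannianBundle (fun x : M => TangentSpace 𝓘(ℝ, E) x)]

/-- The equation of `IsParallel` at the time `t` in the chart around `x₀`, used to argue in a
single chart. -/
def IsParallelInChart (x₀ : M) (γ : ℝ → M) (V : ∀ t, TangentSpace 𝓘(ℝ, E) (γ t)) (t : ℝ) : Prop :=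
  DifferentiableAt ℝ (coordField x₀ γ V) t ∧
    ∀ z : E,
      coordMetric x₀ (extChartAt 𝓘(ℝ, E) x₀ (γ t)) (deriv (coordField x₀ γ V) t) z
        + christoffel x₀ (extChartAt 𝓘(ℝ, E) x₀ (γ t))
            (coordField x₀ γ (velocity γ) t) (coordField x₀ γ V t) z = 0

/-- The field `V` along `γ` is parallel at the time `t`: the pointwise form of `IsParallel`, needed
for fields that are parallel on an interval only. -/
def IsParallelAt (γ : ℝ → M) (V : ∀ t, TangentSpace 𝓘(ℝ, E) (γ t)) (t : ℝ) : Prop :=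
  ∀ x₀ : M, γ t ∈ (chartAt E x₀).source → IsParallelInChart x₀ γ V t

theorem isParallel_iff_forall_isParallelAt : IsParallel γ V ↔ ∀ t, IsParallelAt γ V t :=
  forall_comm

theorem IsParallelAt.congr (h : IsParallelAt γ V t) (hVW : ∀ᶠ s in 𝓝 t, V s = W s) :
    IsParallelAt γ W t := by
  intro x₀ hx₀
  have hcoord := coordField_congr x₀ hVW
  obtain ⟨hV, heq⟩ := h x₀ hx₀
  refine ⟨hcoord.differentiableAt_iff.1 hV, ?_⟩
  rwa [← hcoord.deriv_eq, ← hcoord.eq_of_nhds]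

variable [FiniteDimensional ℝ E] [IsManifold 𝓘(ℝ, E) ∞ M]
  [IsContMDiffRiemannianBundle 𝓘(ℝ, E) ∞ E (fun x : M => TangentSpace 𝓘(ℝ, E) x)]

theorem isParallelInChart_iff (hx₀ : γ t ∈ (chartAt E x₀).source) :
    IsParallelInChart x₀ γ V t ↔ DifferentiableAt ℝ (coordField x₀ γ V) t ∧
      metricForm x₀ (extChartAt 𝓘(ℝ, E) x₀ (γ t)) (deriv (coordField x₀ γ V) t)
        + christoffelForm (metricForm x₀) (extChartAt 𝓘(ℝ, E) x₀ (γ t))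
            (coordField x₀ γ (velocity γ) t) (coordField x₀ γ V t) = 0 := by
  refine and_congr_right fun _ => ?_
  simp only [christoffel_eq_christoffelForm (extChartAt_mem_target hx₀), ← metricForm_apply,
    ContinuousLinearMap.ext_iff, add_apply, zero_apply]

theorem IsParallelInChart.change_chart (hγ : MDifferentiable 𝓘(ℝ, ℝ) 𝓘(ℝ, E) γ)
    (h₀ : γ t ∈ (chartAt E x₀).source) (h₁ : γ t ∈ (chartAt E x₁).source)
    (h : IsParallelInChart x₀ γ V t) : IsParallelInChart x₁ γ V t := by
  obtain ⟨hV, heq⟩ := (isParallelInChart_iff h₀).1 h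
  have hV₁ := hasDerivAt_coordField_chartTransition hγ h₀ h₁ hV
  refine (isParallelInChart_iff h₁).2 ⟨hV₁.differentiableAt, ?_⟩
  ext z₁
  obtain ⟨z, rfl⟩ := surjective_fderiv_chartTransition h₀ h₁ z₁
  have hy := extChartAt_mem_chartTransition_source h₀ h₁
  have hτ : ContDiffAt ℝ ∞ (chartTransition x₀ x₁) (extChartAt 𝓘(ℝ, E) x₀ (γ t)) :=
    contDiffAt_chartTransition hy
  have hpull := christoffelForm_pullback (G := metricForm x₀) (H := metricForm x₁)
    (hτ.of_le (by norm_cast)) (differentiableAt_metricForm (extChartAt_mem_target h₀))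
    (differentiableAt_metricForm (by
      rw [chartTransition_extChartAt x₁ h₀]; exact extChartAt_mem_target h₁)) (metricForm_symm x₁ _)
    ((isOpen_chartTransition_source x₀ x₁).eventually_mem hy |>.mono
      fun y' hy' => metricForm_chartTransition hy')
    (coordField x₀ γ (velocity γ) t) (coordField x₀ γ V t) z
  have hmetric := metricForm_chartTransition hy (deriv (coordField x₀ γ V) t) z
  have heq_z := congrArg (fun A : E →L[ℝ] ℝ => A z) heq
  simp only [add_apply, zero_apply] at heq_z ⊢
  rw [hpull, hmetric, fderiv_chartTransition_coordField _ h₀ h₁,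
    fderiv_chartTransition_coordField _ h₀ h₁, chartTransition_extChartAt x₁ h₀] at heq_z
  rw [hV₁.deriv, map_add, add_apply]
  linarith

theorem IsParallelInChart.isParallelAt (hγ : MDifferentiable 𝓘(ℝ, ℝ) 𝓘(ℝ, E) γ)
    (h₀ : γ t ∈ (chartAt E x₀).source) (h : IsParallelInChart x₀ γ V t) : IsParallelAt γ V t :=
  fun _ h₁ => h.change_chart hγ h₀ h₁

theorem IsParallelAt.add (hV : IsParallelAt γ V t) (hW : IsParallelAt γ W t) :
    IsParallelAt γ (fun s => V s + W s) t := by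
  intro x₀ hx₀
  obtain ⟨hV, hVeq⟩ := (isParallelInChart_iff hx₀).1 (hV x₀ hx₀)
  obtain ⟨hW, hWeq⟩ := (isParallelInChart_iff hx₀).1 (hW x₀ hx₀)
  rw [isParallelInChart_iff hx₀, coordField_add]
  refine ⟨hV.add hW, ?_⟩
  rw [deriv_add hV hW, Pi.add_apply, map_add, map_add, add_add_add_comm, hVeq, hWeq, add_zero]

theorem IsParallelAt.const_smul (hV : IsParallelAt γ V t) (a : ℝ) :
    IsParallelAt γ (fun s => a • V s) t := by
  intro x₀ hx₀
  obtain ⟨hV, hVeq⟩ := (isParallelInChart_iff hx₀).1 (hV x₀ hx₀)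
  rw [isParallelInChart_iff hx₀, coordField_const_smul]
  refine ⟨hV.const_smul a, ?_⟩
  rw [deriv_const_smul a hV, Pi.smul_apply, map_smul, map_smul, ← smul_add, hVeq, smul_zero]

theorem IsParallelAt.hasDerivAt_inner (hγ : MDifferentiableAt 𝓘(ℝ, ℝ) 𝓘(ℝ, E) γ t)
    (hV : IsParallelAt γ V t) (hW : IsParallelAt γ W t) :
    HasDerivAt (fun s => inner ℝ (V s) (W s)) 0 t := by
  set x₀ := γ t
  have hx₀ : γ t ∈ (chartAt E x₀).source := mem_chart_source E x₀
  obtain ⟨hV, hVeq⟩ := (isParallelInChart_iff hx₀).1 (hV x₀ hx₀)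
  obtain ⟨hW, hWeq⟩ := (isParallelInChart_iff hx₀).1 (hW x₀ hx₀)
  have hinner : (fun s => inner ℝ (V s) (W s)) =ᶠ[𝓝 t] fun s =>
      metricForm x₀ (extChartAt 𝓘(ℝ, E) x₀ (γ s)) (coordField x₀ γ V s) (coordField x₀ γ W s) :=
    (hγ.continuousAt.eventually ((chartAt E x₀).open_source.eventually_mem hx₀)).mono
      fun s hs => (metricForm_mfderiv_extChartAt hs (V s) (W s)).symm
  have hy := extChartAt_mem_target hx₀
  refine hinner.hasDerivAt_iff.2 ((hasDerivAt_bilin_apply (differentiableAt_metricForm hy)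
    (hasDerivAt_extChartAt_comp hγ hx₀) hV.hasDerivAt hW.hasDerivAt).congr_deriv ?_)
  have hVeq_W := congrArg (fun A : E →L[ℝ] ℝ => A (coordField x₀ γ W t)) hVeq
  have hWeq_V := congrArg (fun A : E →L[ℝ] ℝ => A (coordField x₀ γ V t)) hWeq
  simp only [add_apply, zero_apply] at hVeq_W hWeq_V
  rw [metricForm_symm] at hWeq_V
  rw [← christoffelForm_add_swap (fderiv_metricForm_symm hy)]
  linarith

variable {I : Set ℝ} {a b : ℝ}

theorem inner_eq_of_isParallelAt (hγ : MDifferentiable 𝓘(ℝ, ℝ) 𝓘(ℝ, E) γ) (hI : IsOpen I)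
    (hI' : I.OrdConnected) (hV : ∀ t ∈ I, IsParallelAt γ V t) (hW : ∀ t ∈ I, IsParallelAt γ W t)
    (ha : a ∈ I) (hb : b ∈ I) : inner ℝ (V a) (W a) = inner ℝ (V b) (W b) := by
  have hderiv : ∀ t ∈ I, HasDerivAt (fun s => inner ℝ (V s) (W s)) 0 t := fun t ht =>
    (hV t ht).hasDerivAt_inner (hγ t) (hW t ht)
  exact hI.is_const_of_deriv_eq_zero (f := fun s => inner ℝ (V s) (W s)) hI'.isPreconnected
    (fun t ht => (hderiv t ht).differentiableAt.differentiableWithinAt)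
    (fun t ht => (hderiv t ht).deriv) ha hb

theorem eq_of_isParallelAt (hγ : MDifferentiable 𝓘(ℝ, ℝ) 𝓘(ℝ, E) γ) (hI : IsOpen I)
    (hI' : I.OrdConnected) (hV : ∀ t ∈ I, IsParallelAt γ V t) (hW : ∀ t ∈ I, IsParallelAt γ W t)
    (ha : a ∈ I) (hb : b ∈ I) (h : V a = W a) : V b = W b := by
  have hdiff : ∀ t ∈ I, IsParallelAt γ (fun s => V s + (-1 : ℝ) • W s) t := fun t ht =>
    (hV t ht).add ((hW t ht).const_smul _)
  have hinner := inner_eq_of_isParallelAt hγ hI hI' hdiff hdiff ha hb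
  simp only [h, neg_smul, one_smul, add_neg_cancel, inner_zero_left] at hinner
  exact add_neg_eq_zero.1 (inner_self_eq_zero.1 hinner.symm)

/-- The linear map `A t` for which the equation of parallel fields in the chart around `x₀` is
`V̂' = A t V̂`. -/
def transportGenerator (x₀ : M) (γ : ℝ → M) (t : ℝ) : E →L[ℝ] E :=
  -((metricForm x₀ (extChartAt 𝓘(ℝ, E) x₀ (γ t))).inverse ∘L
    christoffelForm (metricForm x₀) (extChartAt 𝓘(ℝ, E) x₀ (γ t)) (coordField x₀ γ (velocity γ) t))

theorem isParallelInChart_of_hasDerivAt (hx₀ : γ t ∈ (chartAt E x₀).source)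
    (hV : HasDerivAt (coordField x₀ γ V) (transportGenerator x₀ γ t (coordField x₀ γ V t)) t) :
    IsParallelInChart x₀ γ V t := by
  refine (isParallelInChart_iff hx₀).2 ⟨hV.differentiableAt, ?_⟩
  have hinv := isInvertible_metricForm (E := E) (extChartAt_mem_target hx₀)
  have hgenerator (v : E) : transportGenerator x₀ γ t v
      = -(metricForm x₀ (extChartAt 𝓘(ℝ, E) x₀ (γ t))).inverse
        (christoffelForm (metricForm x₀) (extChartAt 𝓘(ℝ, E) x₀ (γ t))
          (coordField x₀ γ (velocity γ) t) v) := rfl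
  rw [hV.deriv, hgenerator, map_neg, hinv.self_apply_inverse, neg_add_cancel]

theorem continuousOn_inverse_metricForm {X : Type*} [TopologicalSpace X] {c : X → E} {S : Set X}
    (hc : ContinuousOn c S) (hS : ∀ t ∈ S, c t ∈ (extChartAt 𝓘(ℝ, E) x₀).target) :
    ContinuousOn (fun t => (metricForm x₀ (c t)).inverse) S := fun t ht => by
  have : CompleteSpace E := FiniteDimensional.complete ℝ E
  exact ContinuousAt.comp_continuousWithinAt (f := fun s => metricForm x₀ (c s))
    (continuousAt_inverse_clm (isInvertible_metricForm (hS t ht)))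
    (ContinuousAt.comp_continuousWithinAt (f := c) (contDiffAt_metricForm (hS t ht)).continuousAt
      (hc t ht))

theorem continuousOn_transportGenerator (hγ : ContMDiff 𝓘(ℝ, ℝ) 𝓘(ℝ, E) 1 γ) (x₀ : M) :
    ContinuousOn (transportGenerator (E := E) x₀ γ) (γ ⁻¹' (chartAt E x₀).source) := by
  have hcurve : ContinuousOn (fun t => extChartAt 𝓘(ℝ, E) x₀ (γ t))
      (γ ⁻¹' (chartAt E x₀).source) :=
    fun t ht => (contDiffAt_extChartAt_comp (hγ t) ht).continuousAt.continuousWithinAt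
  have hmetric : ∀ t ∈ γ ⁻¹' (chartAt E x₀).source, ContDiffAt ℝ 1 (metricForm (E := E) x₀)
      (extChartAt 𝓘(ℝ, E) x₀ (γ t)) := fun t ht =>
    (contDiffAt_metricForm (extChartAt_mem_target ht)).of_le (by simp)
  have hchristoffel :=
    continuousOn_christoffelForm hmetric hcurve (continuousOn_coordField_velocity hγ x₀)
  have hinverse := continuousOn_inverse_metricForm hcurve fun t ht => extChartAt_mem_target ht
  exact (ContinuousOn.clm_comp hinverse hchristoffel).neg

theorem exists_ball_forall_isParallelAt (hγ : ContMDiff 𝓘(ℝ, ℝ) 𝓘(ℝ, E) 1 γ) (t₀ : ℝ) :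
    ∃ ε > 0, ∀ t₁ ∈ Metric.ball t₀ ε, ∀ w : TangentSpace 𝓘(ℝ, E) (γ t₁),
      ∃ V : ∀ t, TangentSpace 𝓘(ℝ, E) (γ t), V t₁ = w ∧
        ∀ t ∈ Metric.ball t₀ ε, IsParallelAt γ V t := by
  have : CompleteSpace E := FiniteDimensional.complete ℝ E
  set x₀ := γ t₀
  have hsource : γ ⁻¹' (chartAt E x₀).source ∈ 𝓝 t₀ :=
    hγ.continuous.continuousAt ((chartAt E x₀).open_source.mem_nhds (mem_chart_source E x₀))
  obtain ⟨ε, hε, hball, hODE⟩ :=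
    exists_ball_forall_hasDerivAt_clm_apply hsource (continuousOn_transportGenerator hγ x₀)
  have hinv : ∀ t ∈ Metric.ball t₀ ε,
      (mfderiv 𝓘(ℝ, E) 𝓘(ℝ, E) (extChartAt 𝓘(ℝ, E) x₀) (γ t)).IsInvertible := fun t ht =>
    isInvertible_mfderiv_extChartAt (by rw [extChartAt_source]; exact hball ht)
  refine ⟨ε, hε, fun t₁ ht₁ w => ?_⟩
  obtain ⟨α, hα₁, hα⟩ := hODE t₁ ht₁ (mfderiv 𝓘(ℝ, E) 𝓘(ℝ, E) (extChartAt 𝓘(ℝ, E) x₀) (γ t₁) w)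
  let V : ∀ t, TangentSpace 𝓘(ℝ, E) (γ t) := fun t =>
    (mfderiv 𝓘(ℝ, E) 𝓘(ℝ, E) (extChartAt 𝓘(ℝ, E) x₀) (γ t)).inverse (α t)
  have hcoord : ∀ t ∈ Metric.ball t₀ ε, coordField x₀ γ V t = α t :=
    fun t ht => (hinv t ht).self_apply_inverse _
  refine ⟨V, ?_, fun t ht => ?_⟩
  · exact (congrArg _ hα₁).trans ((hinv t₁ ht₁).inverse_apply_self w)
  · have hVα : coordField x₀ γ V =ᶠ[𝓝 t] α :=
      (Metric.isOpen_ball.eventually_mem ht).mono hcoord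
    refine (isParallelInChart_of_hasDerivAt (hball ht) ?_).isParallelAt
      (hγ.mdifferentiable one_ne_zero) (hball ht)
    rw [hcoord t ht]
    exact (hα t ht).congr_of_eventuallyEq hVα

theorem exists_isParallelAt_union (hγ : MDifferentiable 𝓘(ℝ, ℝ) 𝓘(ℝ, E) γ) {J : Set ℝ}
    (hI : IsOpen I) (hI' : I.OrdConnected) (hJ : IsOpen J) (hJ' : J.OrdConnected)
    (hV : ∀ t ∈ I, IsParallelAt γ V t) (hW : ∀ t ∈ J, IsParallelAt γ W t)
    (hbI : b ∈ I) (hbJ : b ∈ J) (h : V b = W b) :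
    ∃ Z : ∀ t, TangentSpace 𝓘(ℝ, E) (γ t), (∀ t ∈ I, Z t = V t) ∧
      ∀ t ∈ I ∪ J, IsParallelAt γ Z t := by
  classical
  let Z : ∀ t, TangentSpace 𝓘(ℝ, E) (γ t) := fun t => if t ∈ I then V t else W t
  have hZV : ∀ t ∈ I, Z t = V t := fun t ht => if_pos ht
  have hZW : ∀ t ∈ J, Z t = W t := by
    intro t htJ
    by_cases htI : t ∈ I
    · exact (hZV t htI).trans (eq_of_isParallelAt hγ (hI.inter hJ) (hI'.inter hJ')
        (fun s hs => hV s hs.1) (fun s hs => hW s hs.2) ⟨hbI, hbJ⟩ ⟨htI, htJ⟩ h)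
    · exact if_neg htI
  refine ⟨Z, hZV, ?_⟩
  rintro t (ht | ht)
  · exact (hV t ht).congr ((hI.eventually_mem ht).mono fun s hs => (hZV s hs).symm)
  · exact (hW t ht).congr ((hJ.eventually_mem ht).mono fun s hs => (hZW s hs).symm)

theorem exists_ordConnected_forall_isParallelAt (hγ : ContMDiff 𝓘(ℝ, ℝ) 𝓘(ℝ, E) 1 γ) (a b : ℝ)
    (w : TangentSpace 𝓘(ℝ, E) (γ a)) :
    ∃ I : Set ℝ, IsOpen I ∧ I.OrdConnected ∧ a ∈ I ∧ b ∈ I ∧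
      ∃ V : ∀ t, TangentSpace 𝓘(ℝ, E) (γ t), V a = w ∧ ∀ t ∈ I, IsParallelAt γ V t := by
  set S := {b : ℝ | ∃ I : Set ℝ, IsOpen I ∧ I.OrdConnected ∧ a ∈ I ∧ b ∈ I ∧
    ∃ V : ∀ t, TangentSpace 𝓘(ℝ, E) (γ t), V a = w ∧ ∀ t ∈ I, IsParallelAt γ V t}
  have hmem : a ∈ S := by
    obtain ⟨ε, hε, hlocal⟩ := exists_ball_forall_isParallelAt hγ a
    exact ⟨Metric.ball a ε, Metric.isOpen_ball, (convex_ball a ε).ordConnected,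
      Metric.mem_ball_self hε, Metric.mem_ball_self hε, hlocal a (Metric.mem_ball_self hε) w⟩
  have hopen : IsOpen S := isOpen_iff_mem_nhds.2 fun b ⟨I, hI, hI', haI, hbI, hV⟩ =>
    mem_of_superset (hI.mem_nhds hbI) fun c hc => ⟨I, hI, hI', haI, hc, hV⟩
  have hclosed : IsClosed S := by
    refine isClosed_of_closure_subset fun t₀ ht₀ => ?_
    obtain ⟨ε, hε, hlocal⟩ := exists_ball_forall_isParallelAt hγ t₀
    obtain ⟨b, hbJ, I, hI, hI', haI, hbI, V, hVa, hV⟩ :=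
      mem_closure_iff.1 ht₀ _ Metric.isOpen_ball (Metric.mem_ball_self hε)
    have hJ' : (Metric.ball t₀ ε).OrdConnected := (convex_ball t₀ ε).ordConnected
    obtain ⟨W, hWb, hW⟩ := hlocal b hbJ (V b)
    obtain ⟨Z, hZV, hZ⟩ := exists_isParallelAt_union (hγ.mdifferentiable one_ne_zero) hI hI'
      Metric.isOpen_ball hJ' hV hW hbI hbJ hWb.symm
    exact ⟨I ∪ Metric.ball t₀ ε, hI.union Metric.isOpen_ball,
      (hI'.isPreconnected.union b hbI hbJ hJ'.isPreconnected).ordConnected, Or.inl haI,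
      Or.inr (Metric.mem_ball_self hε), Z, (hZV a haI).trans hVa, hZ⟩
  exact eq_univ_iff_forall.1 (IsClopen.eq_univ ⟨hclosed, hopen⟩ ⟨a, hmem⟩) b

theorem exists_forall_isParallelAt (hγ : ContMDiff 𝓘(ℝ, ℝ) 𝓘(ℝ, E) 1 γ) (a : ℝ)
    (w : TangentSpace 𝓘(ℝ, E) (γ a)) :
    ∃ V : ∀ t, TangentSpace 𝓘(ℝ, E) (γ t), V a = w ∧ ∀ t, IsParallelAt γ V t := by
  choose I hI hI' haI hbI V hVa hV using
    fun b => exists_ordConnected_forall_isParallelAt hγ a b w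
  refine ⟨fun b => V b b, hVa a, fun b => (hV b b (hbI b)).congr ?_⟩
  refine ((hI b).eventually_mem (hbI b)).mono fun c hc => ?_
  exact eq_of_isParallelAt (hγ.mdifferentiable one_ne_zero) ((hI b).inter (hI c))
    ((hI' b).inter (hI' c)) (fun s hs => hV b s hs.1) (fun s hs => hV c s hs.2)
    ⟨haI b, haI c⟩ ⟨hc, hbI c⟩ ((hVa b).trans (hVa c).symm)

theorem exists_isParallelAt_parallelTransport (hγ : ContMDiff 𝓘(ℝ, ℝ) 𝓘(ℝ, E) 1 γ) (a : ℝ)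
    (w : TangentSpace 𝓘(ℝ, E) (γ a)) :
    ∃ V : ∀ t, TangentSpace 𝓘(ℝ, E) (γ t), V a = w ∧ (∀ t, IsParallelAt γ V t) ∧
      ∀ b, parallelTransport γ a b w = V b := by
  have h : ∃ V : ∀ t, TangentSpace 𝓘(ℝ, E) (γ t), IsParallel γ V ∧ V a = w := by
    obtain ⟨V, hVa, hV⟩ := exists_forall_isParallelAt hγ a w
    exact ⟨V, isParallel_iff_forall_isParallelAt.2 hV, hVa⟩
  exact ⟨h.choose, h.choose_spec.2, isParallel_iff_forall_isParallelAt.1 h.choose_spec.1,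
    fun _ => dif_pos h⟩

theorem parallelTransport_eq (hγ : ContMDiff 𝓘(ℝ, ℝ) 𝓘(ℝ, E) 1 γ)
    (hV : ∀ t, IsParallelAt γ V t) (a b : ℝ) : parallelTransport γ a b (V a) = V b := by
  obtain ⟨W, hWa, hW, hWb⟩ := exists_isParallelAt_parallelTransport hγ a (V a)
  rw [hWb]
  exact eq_of_isParallelAt (hγ.mdifferentiable one_ne_zero) isOpen_univ ordConnected_univ
    (fun t _ => hW t) (fun t _ => hV t) (mem_univ a) (mem_univ b) hWa

theorem inner_parallelTransport (hγ : ContMDiff 𝓘(ℝ, ℝ) 𝓘(ℝ, E) 1 γ) (a b : ℝ)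
    (v w : TangentSpace 𝓘(ℝ, E) (γ a)) :
    inner ℝ (parallelTransport γ a b v) (parallelTransport γ a b w) = inner ℝ v w := by
  obtain ⟨V, rfl, hV, hVb⟩ := exists_isParallelAt_parallelTransport hγ a v
  obtain ⟨W, rfl, hW, hWb⟩ := exists_isParallelAt_parallelTransport hγ a w
  rw [hVb, hWb]
  exact inner_eq_of_isParallelAt (hγ.mdifferentiable one_ne_zero) isOpen_univ ordConnected_univ
    (fun t _ => hV t) (fun t _ => hW t) (mem_univ b) (mem_univ a)

theorem parallelTransport_add (hγ : ContMDiff 𝓘(ℝ, ℝ) 𝓘(ℝ, E) 1 γ) (a b : ℝ)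
    (v w : TangentSpace 𝓘(ℝ, E) (γ a)) :
    parallelTransport γ a b (v + w) = parallelTransport γ a b v + parallelTransport γ a b w := by
  obtain ⟨V, rfl, hV, hVb⟩ := exists_isParallelAt_parallelTransport hγ a v
  obtain ⟨W, rfl, hW, hWb⟩ := exists_isParallelAt_parallelTransport hγ a w
  rw [hVb, hWb]
  exact parallelTransport_eq hγ (fun t => (hV t).add (hW t)) a b

theorem parallelTransport_smul (hγ : ContMDiff 𝓘(ℝ, ℝ) 𝓘(ℝ, E) 1 γ) (a b r : ℝ)
    (v : TangentSpace 𝓘(ℝ, E) (γ a)) :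
    parallelTransport γ a b (r • v) = r • parallelTransport γ a b v := by
  obtain ⟨V, rfl, hV, hVb⟩ := exists_isParallelAt_parallelTransport hγ a v
  rw [hVb]
  exact parallelTransport_eq hγ (fun t => (hV t).const_smul r) a b

theorem parallelTransport_parallelTransport (hγ : ContMDiff 𝓘(ℝ, ℝ) 𝓘(ℝ, E) 1 γ) (a b : ℝ)
    (v : TangentSpace 𝓘(ℝ, E) (γ a)) :
    parallelTransport γ b a (parallelTransport γ a b v) = v := by
  obtain ⟨V, rfl, hV, hVb⟩ := exists_isParallelAt_parallelTransport hγ a v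
  rw [hVb, parallelTransport_eq hγ hV]

/-- Parallel transport along a `C¹` curve, bundled as a linear isometry. -/
def parallelTransportₗᵢ (hγ : ContMDiff 𝓘(ℝ, ℝ) 𝓘(ℝ, E) 1 γ) (a b : ℝ) :
    TangentSpace 𝓘(ℝ, E) (γ a) →ₗᵢ[ℝ] TangentSpace 𝓘(ℝ, E) (γ b) where
  toFun := parallelTransport γ a b
  map_add' := parallelTransport_add hγ a b
  map_smul' := parallelTransport_smul hγ a b
  norm_map' v := by
    rw [norm_eq_sqrt_real_inner, norm_eq_sqrt_real_inner v]
    exact congrArg Real.sqrt (inner_parallelTransport hγ a b v v)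

end Equation

end ParallelFields

section Objective

variable {E : Type*} [NormedAddCommGroup E] [NormedSpace ℝ E]
  {M : Type*} [TopologicalSpace M] [ChartedSpace E M] {n : ℕ} {f : Fin n → M → ℝ}

theorem hasMFDerivAt_objective (hf : ∀ i, MDifferentiable 𝓘(ℝ, E) 𝓘(ℝ, ℝ) (f i)) (x : M) :
    HasMFDerivAt 𝓘(ℝ, E) 𝓘(ℝ, ℝ) (objective f) x ((1 / (n : ℝ)) •
      ∑ i, (mfderiv 𝓘(ℝ, E) 𝓘(ℝ, ℝ) (f i) x : TangentSpace 𝓘(ℝ, E) x →L[ℝ] ℝ)) := by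
  have hsum : HasMFDerivAt 𝓘(ℝ, E) 𝓘(ℝ, ℝ) (∑ i, f i) x
      (∑ i, (mfderiv 𝓘(ℝ, E) 𝓘(ℝ, ℝ) (f i) x : TangentSpace 𝓘(ℝ, E) x →L[ℝ] ℝ)) :=
    HasMFDerivAt.sum fun i _ => (hf i x).hasMFDerivAt
  have hobj : objective f = (1 / (n : ℝ)) • ∑ i, f i := by
    funext y
    simp [objective]
  rw [hobj]
  exact hsum.const_smul (1 / (n : ℝ))

theorem mdifferentiable_objective (hf : ∀ i, MDifferentiable 𝓘(ℝ, E) 𝓘(ℝ, ℝ) (f i)) :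
    MDifferentiable 𝓘(ℝ, E) 𝓘(ℝ, ℝ) (objective f) :=
  fun x => (hasMFDerivAt_objective hf x).mdifferentiableAt

end Objective

section Gradients

variable {E : Type*} [NormedAddCommGroup E] [NormedSpace ℝ E] [FiniteDimensional ℝ E]
  {M : Type*} [TopologicalSpace M] [ChartedSpace E M]
  [RiemannianBundle (fun x : M => TangentSpace 𝓘(ℝ, E) x)]

theorem inner_riemGrad (f : M → ℝ) (x : M) (v : TangentSpace 𝓘(ℝ, E) x) :
    inner ℝ (riemGrad f x) v = mfderiv 𝓘(ℝ, E) 𝓘(ℝ, ℝ) f x v := by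
  have : FiniteDimensional ℝ (TangentSpace 𝓘(ℝ, E) x) := inferInstanceAs (FiniteDimensional ℝ E)
  have : CompleteSpace (TangentSpace 𝓘(ℝ, E) x) := FiniteDimensional.complete ℝ _
  exact InnerProductSpace.toDual_symm_apply

theorem riemGrad_objective {n : ℕ} {f : Fin n → M → ℝ}
    (hf : ∀ i, MDifferentiable 𝓘(ℝ, E) 𝓘(ℝ, ℝ) (f i)) (x : M) :
    riemGrad (E := E) (objective f) x = (1 / (n : ℝ)) • ∑ i, riemGrad (f i) x := by
  refine ext_inner_right ℝ fun v => ?_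
  rw [inner_riemGrad, inner_smul_left, sum_inner, (hasMFDerivAt_objective hf x).mfderiv]
  simp only [inner_riemGrad]
  let df : Fin n → TangentSpace 𝓘(ℝ, E) x →L[ℝ] ℝ := fun i => mfderiv 𝓘(ℝ, E) 𝓘(ℝ, ℝ) (f i) x
  exact congrArg (1 / (n : ℝ) * ·) (sum_apply Finset.univ df v)

end Gradients

section Curves

variable {E : Type*} [NormedAddCommGroup E] [NormedSpace ℝ E]
  {M : Type*} [TopologicalSpace M] [ChartedSpace E M] {γ : ℝ → M}

theorem velocity_comp_mul (hγ : MDifferentiable 𝓘(ℝ, ℝ) 𝓘(ℝ, E) γ) (τ s : ℝ) :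
    velocity (E := E) (fun s => γ (τ * s)) s = τ • velocity γ (τ * s) := by
  have hmul : HasMFDerivAt 𝓘(ℝ, ℝ) 𝓘(ℝ, ℝ) (fun s : ℝ => τ * s) s
      (τ • ContinuousLinearMap.id ℝ ℝ) :=
    ((hasFDerivAt_id (𝕜 := ℝ) s).const_mul τ).hasMFDerivAt
  have hcomp := (HasMFDerivAt.comp s (hγ (τ * s)).hasMFDerivAt hmul).mfderiv
  exact (congrArg (fun A => A (1 : ℝ)) hcomp).trans
    (map_smul (mfderiv 𝓘(ℝ, ℝ) 𝓘(ℝ, E) γ (τ * s)) τ (1 : ℝ))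

theorem coordField_velocity_comp_mul (hγ : MDifferentiable 𝓘(ℝ, ℝ) 𝓘(ℝ, E) γ) (x₀ : M) (τ : ℝ) :
    coordField x₀ (fun s => γ (τ * s)) (velocity (E := E) fun s => γ (τ * s))
      = fun s => τ • coordField x₀ γ (velocity γ) (τ * s) := by
  funext s
  unfold coordField
  rw [velocity_comp_mul hγ]
  exact map_smul _ _ _

theorem hasDerivAt_comp_curve {f : M → ℝ} {t : ℝ} (hf : MDifferentiableAt 𝓘(ℝ, E) 𝓘(ℝ, ℝ) f (γ t))
    (hγ : MDifferentiableAt 𝓘(ℝ, ℝ) 𝓘(ℝ, E) γ t) :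
    HasDerivAt (fun s => f (γ s)) (mfderiv 𝓘(ℝ, E) 𝓘(ℝ, ℝ) f (γ t) (velocity γ t) : ℝ) t := by
  have h := hf.hasMFDerivAt.comp t hγ.hasMFDerivAt
  exact hasDerivAt_iff_hasFDerivAt.2 (h.hasFDerivAt.congr_fderiv
    (ContinuousLinearMap.ext_ring (one_smul ℝ _).symm))

end Curves

section Geodesics

variable {E : Type*} [NormedAddCommGroup E] [NormedSpace ℝ E]
  {M : Type*} [TopologicalSpace M] [ChartedSpace E M]
  [RiemannianBundle (fun x : M => TangentSpace 𝓘(ℝ, E) x)] {γ : ℝ → M}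

theorem isGeodesicFrom_geod (hM : GeodesicallyComplete E M) (x : M)
    (v : TangentSpace 𝓘(ℝ, E) x) : IsGeodesicFrom x v (geod x v) := by
  unfold geod
  rw [dif_pos (hM x v)]
  exact (hM x v).choose_spec

theorem IsGeodesic.mdifferentiable (hγ : IsGeodesic (E := E) γ) :
    MDifferentiable 𝓘(ℝ, ℝ) 𝓘(ℝ, E) γ :=
  hγ.contMDiff.mdifferentiable (by simp)

theorem IsGeodesic.contMDiff_one (hγ : IsGeodesic (E := E) γ) : ContMDiff 𝓘(ℝ, ℝ) 𝓘(ℝ, E) 1 γ :=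
  hγ.contMDiff.of_le (by simp)

/-- The identification of the tangent spaces at two equal points, needed because the endpoints of
`geod x v` are only propositionally equal to `x` and `riemExp x v`. -/
def tangentCast {x y : M} (h : y = x) :
    TangentSpace 𝓘(ℝ, E) x →ₗᵢ[ℝ] TangentSpace 𝓘(ℝ, E) y where
  toFun w := h.symm ▸ w
  map_add' v w := by subst h; rfl
  map_smul' a v := by subst h; rfl
  norm_map' v := by subst h; rfl

theorem tangentCast_eq_of_mk_eq {x y : M} {u : TangentSpace 𝓘(ℝ, E) y}
    {v : TangentSpace 𝓘(ℝ, E) x} (h : y = x)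
    (huv : (⟨y, u⟩ : TangentBundle 𝓘(ℝ, E) M) = ⟨x, v⟩) : tangentCast h v = u := by
  subst h
  obtain rfl : u = v := by simpa using huv
  rfl

theorem tangentCast_velocity_geod (hM : GeodesicallyComplete E M) (x : M)
    (v : TangentSpace 𝓘(ℝ, E) x) : tangentCast (geod_zero x v) v = velocity (geod x v) 0 :=
  tangentCast_eq_of_mk_eq _ (isGeodesicFrom_geod hM x v).2

variable [FiniteDimensional ℝ E]

theorem tangentCast_riemGrad {x y : M} (h : y = x) (f : M → ℝ) :
    tangentCast h (riemGrad (E := E) f x) = riemGrad f y := by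
  subst h
  rfl

variable [IsManifold 𝓘(ℝ, E) ∞ M]
  [IsContMDiffRiemannianBundle 𝓘(ℝ, E) ∞ E (fun x : M => TangentSpace 𝓘(ℝ, E) x)]

theorem IsGeodesic.comp_mul (hγ : IsGeodesic (E := E) γ) (τ : ℝ) :
    IsGeodesic (E := E) (fun s => γ (τ * s)) := by
  refine ⟨hγ.contMDiff.comp (contDiff_const.mul contDiff_id).contMDiff,
    isParallel_iff_forall_isParallelAt.2 fun s x₀ hx₀ =>
      (isParallelInChart_iff (γ := fun s => γ (τ * s)) hx₀).2 ?_⟩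
  obtain ⟨hdiff, heq⟩ := (isParallelInChart_iff hx₀).1
    (isParallel_iff_forall_isParallelAt.1 hγ.parallel_velocity (τ * s) x₀ hx₀)
  have hmul : HasDerivAt (fun s : ℝ => τ * s) τ s := by
    simpa using (hasDerivAt_id s).const_mul τ
  have hderiv : HasDerivAt (fun s => τ • coordField x₀ γ (velocity γ) (τ * s))
      (τ • τ • deriv (coordField x₀ γ (velocity γ)) (τ * s)) s :=
    (HasDerivAt.scomp s hdiff.hasDerivAt hmul).fun_const_smul τ
  rw [coordField_velocity_comp_mul hγ.mdifferentiable]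
  refine ⟨hderiv.differentiableAt, ?_⟩
  ext z
  simp only [hderiv.deriv, map_smul, add_apply, smul_apply, christoffelForm_smul, smul_eq_mul,
    zero_apply, ← mul_add]
  rw [← add_apply, heq, zero_apply, mul_zero, mul_zero]

/-- The parallel transport `expTransport` along `t ↦ Exp_x(t v)`, bundled as a linear isometry. -/
def expTransportₗᵢ (hM : GeodesicallyComplete E M) (x : M) (v : TangentSpace 𝓘(ℝ, E) x) :
    TangentSpace 𝓘(ℝ, E) x →ₗᵢ[ℝ] TangentSpace 𝓘(ℝ, E) (riemExp x v) :=
  (parallelTransportₗᵢ (isGeodesicFrom_geod hM x v).1.contMDiff_one 0 1).comp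
    (tangentCast (geod_zero x v))

end Geodesics

section GeodesicSmoothness

open Set

variable {E : Type*} [NormedAddCommGroup E] [NormedSpace ℝ E] [FiniteDimensional ℝ E]
  {M : Type*} [TopologicalSpace M] [ChartedSpace E M] [IsManifold 𝓘(ℝ, E) ∞ M]
  [RiemannianBundle (fun x : M => TangentSpace 𝓘(ℝ, E) x)]
  [IsContMDiffRiemannianBundle 𝓘(ℝ, E) ∞ E (fun x : M => TangentSpace 𝓘(ℝ, E) x)]
  {L : ℝ} {f : M → ℝ} {γ : ℝ → M}

theorem IsGSmooth.inner_velocity_one_le (hf : IsGSmooth E L f) (hγ : IsGeodesic (E := E) γ) :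
    inner ℝ (riemGrad f (γ 1)) (velocity (E := E) γ 1)
      ≤ inner ℝ (riemGrad f (γ 0)) (velocity (E := E) γ 0) + L * ‖velocity (E := E) γ 0‖ ^ 2 := by
  have htransport := inner_parallelTransport hγ.contMDiff_one 1 0 (riemGrad (E := E) f (γ 1))
    (velocity γ 1)
  rw [parallelTransport_eq hγ.contMDiff_one
    (isParallel_iff_forall_isParallelAt.1 hγ.parallel_velocity)] at htransport
  rw [← htransport, ← sub_le_iff_le_add', ← inner_sub_left, pow_two, ← mul_assoc]
  refine (real_inner_le_norm _ _).trans (mul_le_mul_of_nonneg_right ?_ (norm_nonneg _))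
  rw [norm_sub_rev]
  exact hf.lipschitz γ hγ

theorem IsGSmooth.inner_velocity_le (hf : IsGSmooth E L f) (hγ : IsGeodesic (E := E) γ) {t : ℝ}
    (ht : 0 ≤ t) :
    inner ℝ (riemGrad f (γ t)) (velocity (E := E) γ t)
      ≤ inner ℝ (riemGrad f (γ 0)) (velocity (E := E) γ 0)
        + L * ‖velocity (E := E) γ 0‖ ^ 2 * t := by
  obtain rfl | ht := ht.eq_or_lt
  · rw [mul_zero, add_zero]
  have h := hf.inner_velocity_one_le (hγ.comp_mul t)
  rw [velocity_comp_mul hγ.mdifferentiable, velocity_comp_mul hγ.mdifferentiable, norm_smul,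
    inner_smul_right, inner_smul_right, mul_one, mul_zero, mul_pow, Real.norm_eq_abs, sq_abs] at h
  refine le_of_mul_le_mul_left (h.trans (le_of_eq ?_)) ht
  ring

theorem IsGSmooth.le_along_geodesic (hf : IsGSmooth E L f) (hγ : IsGeodesic (E := E) γ) :
    f (γ 1) ≤ f (γ 0) + inner ℝ (riemGrad f (γ 0)) (velocity (E := E) γ 0)
      + L / 2 * ‖velocity (E := E) γ 0‖ ^ 2 := by
  set a : ℝ := inner ℝ (riemGrad f (γ 0)) (velocity (E := E) γ 0)
  set b : ℝ := L * ‖velocity (E := E) γ 0‖ ^ 2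
  have hderiv (t : ℝ) : HasDerivAt (fun s => f (γ s))
      (inner ℝ (riemGrad f (γ t)) (velocity (E := E) γ t)) t := by
    rw [inner_riemGrad]
    exact hasDerivAt_comp_curve (hf.mdifferentiable _) (hγ.mdifferentiable t)
  have hmodel (t : ℝ) : HasDerivAt (fun s => f (γ 0) + a * s + b / 2 * s ^ 2) (a + b * t) t := by
    refine ((((hasDerivAt_id t).const_mul a).const_add _).add
      (((hasDerivAt_id t).pow 2).const_mul (b / 2))).congr_deriv ?_
    simp only [id]
    ring
  have hle := image_le_of_deriv_right_le_deriv_boundary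
    (fun t _ => (hderiv t).continuousAt.continuousWithinAt)
    (fun t _ => (hderiv t).hasDerivWithinAt) (by simp)
    (fun t _ => (hmodel t).continuousAt.continuousWithinAt)
    (fun t _ => (hmodel t).hasDerivWithinAt)
    (fun t ht => hf.inner_velocity_le hγ ht.1) (right_mem_Icc.2 zero_le_one)
  linarith

theorem IsGSmooth.riemExp_le (hM : GeodesicallyComplete E M) (hf : IsGSmooth E L f) (x : M)
    (v : TangentSpace 𝓘(ℝ, E) x) :
    f (riemExp x v) ≤ f x + inner ℝ (riemGrad f x) v + L / 2 * ‖v‖ ^ 2 := by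
  have h := hf.le_along_geodesic (isGeodesicFrom_geod hM x v).1
  rwa [← tangentCast_velocity_geod hM, ← tangentCast_riemGrad (geod_zero x v),
    LinearIsometry.inner_map_map, LinearIsometry.norm_map, geod_zero] at h

theorem IsGSmooth.norm_riemGrad_riemExp_sub_le (hM : GeodesicallyComplete E M)
    (hf : IsGSmooth E L f) (x : M) (v : TangentSpace 𝓘(ℝ, E) x) :
    ‖riemGrad f (riemExp x v) - expTransportₗᵢ hM x v (riemGrad f x)‖ ≤ L * ‖v‖ := by
  have hgeod := (isGeodesicFrom_geod hM x v).1
  set T := parallelTransportₗᵢ hgeod.contMDiff_one 0 1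
  have h := hf.lipschitz _ hgeod
  rw [← tangentCast_velocity_geod hM, LinearIsometry.norm_map, ← T.norm_map, map_sub,
    norm_sub_rev, ← tangentCast_riemGrad (geod_zero x v)] at h
  rwa [show T _ = _ from parallelTransport_parallelTransport hgeod.contMDiff_one 1 0 _] at h

end GeodesicSmoothness

section Measurability

open Topology Set

theorem measurable_of_forall_measurable_domRestrict_preimage {X Y Z : Type*} [TopologicalSpace X]
    [MeasurableSpace X] [BorelSpace X] [TopologicalSpace Y] [SecondCountableTopology Y]
    [MeasurableSpace Z] {U : Y → Set Y} (hU : ∀ y, IsOpen (U y)) (hmem : ∀ y, y ∈ U y) {φ : X → Y}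
    (hφ : Continuous φ) {g : X → Z} (hg : ∀ y, Measurable ((φ ⁻¹' U y).domRestrict g)) :
    Measurable g := by
  obtain ⟨s, hs, hcover⟩ :=
    TopologicalSpace.countable_cover_nhds fun y => (hU y).mem_nhds (hmem y)
  intro B hB
  have hpreimage : g ⁻¹' B = ⋃ y ∈ s, φ ⁻¹' U y ∩ g ⁻¹' B := by
    rw [← iUnion₂_inter, ← preimage_iUnion₂, hcover, preimage_univ, univ_inter]
  rw [hpreimage]
  refine MeasurableSet.biUnion hs fun y _ => ?_
  rw [← Subtype.image_preimage_coe]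
  exact ((hU y).preimage hφ).measurableSet.subtype_image (hg y hB)

variable {E : Type*} [NormedAddCommGroup E] [NormedSpace ℝ E]
  {M : Type*} [TopologicalSpace M] [ChartedSpace E M]

section

variable [IsManifold 𝓘(ℝ, E) 1 M]

theorem mfderiv_apply_eq_fderiv_comp_extChartAt_symm {f : M → ℝ} {x₀ x : M}
    (hf : MDifferentiableAt 𝓘(ℝ, E) 𝓘(ℝ, ℝ) f x) (hx : x ∈ (chartAt E x₀).source)
    (v : TangentSpace 𝓘(ℝ, E) x) :
    (mfderiv 𝓘(ℝ, E) 𝓘(ℝ, ℝ) f x v : ℝ)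
      = fderiv ℝ (fun y => f ((extChartAt 𝓘(ℝ, E) x₀).symm y)) (extChartAt 𝓘(ℝ, E) x₀ x)
          (mfderiv 𝓘(ℝ, E) 𝓘(ℝ, E) (extChartAt 𝓘(ℝ, E) x₀) x v) := by
  have hfactor : f =ᶠ[𝓝 x]
      (fun y => f ((extChartAt 𝓘(ℝ, E) x₀).symm y)) ∘ extChartAt 𝓘(ℝ, E) x₀ := by
    filter_upwards [(chartAt E x₀).open_source.mem_nhds hx] with x' hx'
    simp only [Function.comp, extChartAt_symm_extChartAt hx']
  have hdiff : MDifferentiableAt 𝓘(ℝ, E) 𝓘(ℝ, ℝ)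
      (fun y => f ((extChartAt 𝓘(ℝ, E) x₀).symm y)) (extChartAt 𝓘(ℝ, E) x₀ x) :=
    MDifferentiableAt.comp _ (by rwa [extChartAt_symm_extChartAt hx])
      (mdifferentiableAt_extChartAt_symm (extChartAt_mem_target hx))
  have hderiv := hfactor.mfderiv_eq.trans
    (mfderiv_comp x hdiff (mdifferentiableAt_extChartAt (I := 𝓘(ℝ, E)) hx))
  rw [mfderiv_eq_fderiv] at hderiv
  exact congrArg (fun A => A v) hderiv

theorem continuous_tangentBundle_proj :
    Continuous (TotalSpace.proj : TangentBundle 𝓘(ℝ, E) M → M) :=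
  FiberBundle.continuous_proj E (TangentSpace 𝓘(ℝ, E))

theorem continuousOn_extChartAt_proj (x₀ : M) :
    ContinuousOn (fun q : TangentBundle 𝓘(ℝ, E) M => extChartAt 𝓘(ℝ, E) x₀ q.proj)
      (TotalSpace.proj ⁻¹' (chartAt E x₀).source) :=
  (continuousOn_extChartAt x₀).comp continuous_tangentBundle_proj.continuousOn fun q hq => by
    rwa [extChartAt_source]

theorem continuousOn_mfderiv_extChartAt (x₀ : M) :
    ContinuousOn (fun q : TangentBundle 𝓘(ℝ, E) M =>
        (mfderiv 𝓘(ℝ, E) 𝓘(ℝ, E) (extChartAt 𝓘(ℝ, E) x₀) q.proj q.2 : E))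
      (TotalSpace.proj ⁻¹' (chartAt E x₀).source) := by
  set e := trivializationAt E (TangentSpace 𝓘(ℝ, E)) x₀
  have hbase {q : TangentBundle 𝓘(ℝ, E) M}
      (hq : q ∈ TotalSpace.proj ⁻¹' (chartAt E x₀).source) : q.proj ∈ e.baseSet := by
    simpa [e] using hq
  have he : ContinuousOn (fun q : TangentBundle 𝓘(ℝ, E) M => (e q).2)
      (TotalSpace.proj ⁻¹' (chartAt E x₀).source) :=
    continuous_snd.comp_continuousOn (e.continuousOn.mono fun q hq => e.mem_source.2 (hbase hq))
  refine he.congr fun q hq => ?_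
  refine (congrArg (fun A => A q.2)
    (TangentBundle.continuousLinearMapAt_trivializationAt (I := 𝓘(ℝ, E)) hq)).symm.trans ?_
  rw [Trivialization.continuousLinearMapAt_apply,
    Trivialization.coe_linearMapAt_of_mem _ (hbase hq)]

theorem measurable_mfderiv_apply [FiniteDimensional ℝ E] [SecondCountableTopology M] {f : M → ℝ}
    (hf : MDifferentiable 𝓘(ℝ, E) 𝓘(ℝ, ℝ) f) :
    Measurable[borel (TangentBundle 𝓘(ℝ, E) M)]
      (fun q : TangentBundle 𝓘(ℝ, E) M => (mfderiv 𝓘(ℝ, E) 𝓘(ℝ, ℝ) f q.proj q.2 : ℝ)) := by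
  borelize (TangentBundle 𝓘(ℝ, E) M)
  borelize E
  have : ProperSpace E := FiniteDimensional.proper ℝ E
  refine measurable_of_forall_measurable_domRestrict_preimage
    (fun x₀ : M => (chartAt E x₀).open_source) (mem_chart_source E) continuous_tangentBundle_proj
    fun x₀ => ?_
  have hdf := (measurable_fderiv ℝ (fun y => f ((extChartAt 𝓘(ℝ, E) x₀).symm y))).comp
    (continuousOn_extChartAt_proj x₀).domRestrict.measurable
  have h := (ContinuousLinearMap.measurable_apply₂ (𝕜 := ℝ) (E := E) (F := ℝ)).comp
    (hdf.prodMk (continuousOn_mfderiv_extChartAt x₀).domRestrict.measurable)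
  convert! h using 1
  funext q
  exact mfderiv_apply_eq_fderiv_comp_extChartAt_symm (hf _) q.2 q.1.2

theorem norm_riemGrad_sq_eq [FiniteDimensional ℝ E]
    [RiemannianBundle (fun x : M => TangentSpace 𝓘(ℝ, E) x)] {f : M → ℝ} {x₀ x : M}
    (hf : MDifferentiableAt 𝓘(ℝ, E) 𝓘(ℝ, ℝ) f x) (hx : x ∈ (chartAt E x₀).source) :
    ‖riemGrad (E := E) f x‖ ^ 2
      = fderiv ℝ (fun y => f ((extChartAt 𝓘(ℝ, E) x₀).symm y)) (extChartAt 𝓘(ℝ, E) x₀ x)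
        ((metricForm x₀ (extChartAt 𝓘(ℝ, E) x₀ x)).inverse
          (fderiv ℝ (fun y => f ((extChartAt 𝓘(ℝ, E) x₀).symm y)) (extChartAt 𝓘(ℝ, E) x₀ x))) := by
  rw [← real_inner_self_eq_norm_sq, inner_riemGrad,
    mfderiv_apply_eq_fderiv_comp_extChartAt_symm hf hx]
  congr 1
  refine ((isInvertible_metricForm (extChartAt_mem_target hx)).inverse_apply_eq.2 ?_).symm
  ext u
  obtain ⟨w, rfl⟩ := (isInvertible_mfderiv_extChartAt (I := 𝓘(ℝ, E)) (x := x₀) (y := x)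
    (by rwa [extChartAt_source])).surjective u
  refine (mfderiv_apply_eq_fderiv_comp_extChartAt_symm hf hx w).symm.trans ?_
  rw [← inner_riemGrad]
  exact (metricForm_mfderiv_extChartAt hx _ _).symm

end

variable [IsManifold 𝓘(ℝ, E) ∞ M] [RiemannianBundle (fun x : M => TangentSpace 𝓘(ℝ, E) x)]
  [IsContMDiffRiemannianBundle 𝓘(ℝ, E) ∞ E (fun x : M => TangentSpace 𝓘(ℝ, E) x)]

theorem continuous_norm_sq_tangentBundle :
    Continuous (fun q : TangentBundle 𝓘(ℝ, E) M => ‖q.2‖ ^ 2) := by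
  have h : ContMDiff 𝓘(ℝ, E).tangent 𝓘(ℝ, ℝ) ∞
      (fun q : TangentBundle 𝓘(ℝ, E) M => inner ℝ q.2 q.2) :=
    ContMDiff.inner_bundle contMDiff_id contMDiff_id
  simpa only [real_inner_self_eq_norm_sq] using h.continuous

variable [FiniteDimensional ℝ E] [SecondCountableTopology M] {f : M → ℝ}

theorem measurable_norm_riemGrad_sq (hf : MDifferentiable 𝓘(ℝ, E) 𝓘(ℝ, ℝ) f) :
    Measurable[borel M] (fun x => ‖riemGrad (E := E) f x‖ ^ 2) := by
  borelize M
  borelize E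
  have : ProperSpace E := FiniteDimensional.proper ℝ E
  have : ProperSpace (E →L[ℝ] ℝ) := FiniteDimensional.proper ℝ _
  refine measurable_of_forall_measurable_domRestrict_preimage
    (fun x₀ : M => (chartAt E x₀).open_source) (mem_chart_source E) continuous_id fun x₀ => ?_
  have hchart : ContinuousOn (extChartAt 𝓘(ℝ, E) x₀) (chartAt E x₀).source := by
    simpa only [extChartAt_source] using continuousOn_extChartAt (I := 𝓘(ℝ, E)) x₀
  have hdf := (measurable_fderiv ℝ (fun y => f ((extChartAt 𝓘(ℝ, E) x₀).symm y))).comp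
    hchart.domRestrict.measurable
  have hinverse := (continuousOn_inverse_metricForm hchart fun x hx =>
    extChartAt_mem_target hx).domRestrict.measurable
  have hdual := (ContinuousLinearMap.measurable_apply₂ (𝕜 := ℝ) (E := E →L[ℝ] ℝ) (F := E)).comp
    (hinverse.prodMk hdf)
  have h := (ContinuousLinearMap.measurable_apply₂ (𝕜 := ℝ) (E := E) (F := ℝ)).comp
    (hdf.prodMk hdual)
  convert! h using 1
  funext x
  exact norm_riemGrad_sq_eq (hf _) x.2

theorem measurable_norm_sub_riemGrad_sq (hf : MDifferentiable 𝓘(ℝ, E) 𝓘(ℝ, ℝ) f) :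
    Measurable[borel (TangentBundle 𝓘(ℝ, E) M)]
      (fun q : TangentBundle 𝓘(ℝ, E) M => ‖q.2 - riemGrad (E := E) f q.proj‖ ^ 2) := by
  borelize (TangentBundle 𝓘(ℝ, E) M)
  borelize M
  have h := (continuous_norm_sq_tangentBundle.measurable.sub
    ((measurable_mfderiv_apply hf).const_mul 2)).add
    ((measurable_norm_riemGrad_sq hf).comp continuous_tangentBundle_proj.measurable)
  convert! h using 1
  funext q
  rw [norm_sub_sq_real, real_inner_comm, inner_riemGrad]
  rfl

end Measurability

section SecondMoment

variable {H : Type*} [NormedAddCommGroup H] [InnerProductSpace ℝ H]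

section Orthogonal

variable {Ω : Type*} [MeasurableSpace Ω] {μ : Measure Ω}

theorem integrable_inner_of_memLp_two {Y Z : Ω → H} (hY : MemLp Y 2 μ) (hZ : MemLp Z 2 μ) :
    Integrable (fun a => inner ℝ (Y a) (Z a)) μ := by
  refine (L2.integrable_inner (𝕜 := ℝ) (hY.toLp Y) (hZ.toLp Z)).congr ?_
  filter_upwards [hY.coeFn_toLp, hZ.coeFn_toLp] with a haY haZ
  rw [haY, haZ]

theorem integral_norm_const_add_sq [CompleteSpace H] [IsProbabilityMeasure μ] {Y : Ω → H}
    (hY : MemLp Y 2 μ) (hY0 : ∫ a, Y a ∂μ = 0) (A : H) :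
    ∫ a, ‖A + Y a‖ ^ 2 ∂μ = ‖A‖ ^ 2 + ∫ a, ‖Y a‖ ^ 2 ∂μ := by
  have hYint : Integrable Y μ := hY.integrable one_le_two
  have hinner : Integrable (fun a => 2 * inner ℝ A (Y a)) μ :=
    (hYint.const_inner A).const_mul 2
  have hlinear : Integrable (fun a => ‖A‖ ^ 2 + 2 * inner ℝ A (Y a)) μ :=
    (integrable_const _).add hinner
  simp only [norm_add_sq_real]
  rw [integral_add hlinear ((memLp_two_iff_integrable_sq_norm hY.1).1 hY),
    integral_add (integrable_const _) hinner, integral_const_mul, integral_inner hYint, hY0]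
  simp

theorem integral_norm_sum_sq_of_pairwise {ι : Type*} [Fintype ι] {Y : ι → Ω → H}
    (hY : ∀ i, MemLp (Y i) 2 μ)
    (horth : Pairwise fun i j => ∫ a, inner ℝ (Y i a) (Y j a) ∂μ = 0) :
    ∫ a, ‖∑ i, Y i a‖ ^ 2 ∂μ = ∑ i, ∫ a, ‖Y i a‖ ^ 2 ∂μ := by
  have hinner (i j : ι) : Integrable (fun a => inner ℝ (Y i a) (Y j a)) μ :=
    integrable_inner_of_memLp_two (hY i) (hY j)
  simp only [← real_inner_self_eq_norm_sq, inner_sum, sum_inner]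
  rw [integral_finsetSum _ fun j _ => integrable_finsetSum _ fun i _ => hinner i j]
  refine Finset.sum_congr rfl fun j _ => ?_
  rw [integral_finsetSum _ fun i _ => hinner i j]
  exact Finset.sum_eq_single j (fun i _ hij => horth hij) fun hj => absurd (Finset.mem_univ j) hj

end Orthogonal

section Product

variable {ι : Type*} [Fintype ι] {S : ι → Type*} [∀ i, MeasurableSpace (S i)]
  {ν : ∀ i, Measure (S i)} [∀ i, IsProbabilityMeasure (ν i)]

theorem memLp_comp_eval {F : Type*} [NormedAddCommGroup F] {q : ENNReal} {i : ι} {X : S i → F}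
    (hX : MemLp X q (ν i)) : MemLp (fun s : ∀ i, S i => X (s i)) q (Measure.pi ν) :=
  hX.comp_measurePreserving (measurePreserving_eval ν i)

variable [CompleteSpace H]

theorem integral_inner_comp_eval_eq_zero {i j : ι} (hij : i ≠ j) {X : S i → H} {Y : S j → H}
    (hX : Integrable X (ν i)) (hY : Integrable Y (ν j)) (hX0 : ∫ a, X a ∂(ν i) = 0) :
    ∫ s : ∀ i, S i, inner ℝ (X (s i)) (Y (s j)) ∂(Measure.pi ν) = 0 := by
  have hind : IndepFun (fun s : ∀ i, S i => s i) (fun s : ∀ i, S i => s j) (Measure.pi ν) :=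
    (iIndepFun_pi (μ := ν) (X := fun _ a => a) fun i => aemeasurable_id).indepFun hij
  refine (hind.integral_bilin_comp_comp (𝕜 := ℝ) (f := X) (g := Y)
    (measurable_pi_apply i).aemeasurable (measurable_pi_apply j).aemeasurable
    (by rwa [(measurePreserving_eval ν i).map_eq])
    (by rwa [(measurePreserving_eval ν j).map_eq]) (innerSL ℝ)).trans ?_
  rw [integral_comp_eval hX.aestronglyMeasurable, hX0, map_zero, zero_apply]

theorem integral_norm_const_add_sum_comp_eval_sq {X : ∀ i, S i → H}
    (hX : ∀ i, MemLp (X i) 2 (ν i)) (hX0 : ∀ i, ∫ a, X i a ∂(ν i) = 0) (A : H) :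
    ∫ s : ∀ i, S i, ‖A + ∑ i, X i (s i)‖ ^ 2 ∂(Measure.pi ν)
      = ‖A‖ ^ 2 + ∑ i, ∫ a, ‖X i a‖ ^ 2 ∂(ν i) := by
  have hXint (i : ι) : Integrable (X i) (ν i) := (hX i).integrable one_le_two
  have hmean : ∫ s : ∀ i, S i, ∑ i, X i (s i) ∂(Measure.pi ν) = 0 := by
    rw [integral_finsetSum _ fun i _ => integrable_comp_eval (hXint i)]
    exact Finset.sum_eq_zero fun i _ =>
      (integral_comp_eval (hXint i).aestronglyMeasurable).trans (hX0 i)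
  have hXeval (i : ι) : MemLp (fun s : ∀ i, S i => X i (s i)) 2 (Measure.pi ν) :=
    memLp_comp_eval (hX i)
  have hXsum : MemLp (fun s : ∀ i, S i => ∑ i, X i (s i)) 2 (Measure.pi ν) :=
    memLp_finsetSum _ fun i _ => hXeval i
  have horth : Pairwise fun i j =>
      ∫ s : ∀ i, S i, inner ℝ (X i (s i)) (X j (s j)) ∂(Measure.pi ν) = 0 := fun i j hij =>
    integral_inner_comp_eval_eq_zero hij (hXint i) (hXint j) (hX0 i)
  have hsq (i : ι) : ∫ s : ∀ i, S i, ‖X i (s i)‖ ^ 2 ∂(Measure.pi ν) = ∫ a, ‖X i a‖ ^ 2 ∂(ν i) :=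
    integral_comp_eval (f := fun a => ‖X i a‖ ^ 2) ((hX i).1.norm.pow 2)
  rw [integral_norm_const_add_sq hXsum hmean, integral_norm_sum_sq_of_pairwise hXeval horth]
  simp only [hsq]

end Product

end SecondMoment

section Coin

variable {p : ℝ}

theorem lintegral_coinLaw (g : Bool → ENNReal) :
    ∫⁻ c, g c ∂(coinLaw p) = ENNReal.ofReal p * g true + ENNReal.ofReal (1 - p) * g false := by
  rw [coinLaw, lintegral_add_measure, lintegral_smul_measure, lintegral_smul_measure,
    lintegral_dirac, lintegral_dirac]
  rfl

theorem lintegral_coinLaw_prod_le {S : Type*} [MeasurableSpace S] {μ : Measure S}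
    (hp0 : 0 ≤ p) (hp1 : p ≤ 1) {F : Bool × S → ENNReal} {A B : ℝ} (hA : 0 ≤ A) (hB : 0 ≤ B)
    (htrue : ∫⁻ s, F (true, s) ∂μ ≤ ENNReal.ofReal A)
    (hfalse : ∫⁻ s, F (false, s) ∂μ ≤ ENNReal.ofReal B) :
    ∫⁻ r, F r ∂((coinLaw p).prod μ) ≤ ENNReal.ofReal (p * A + (1 - p) * B) := by
  have hp1' : 0 ≤ 1 - p := sub_nonneg.2 hp1
  refine (lintegral_prod_le F).trans ?_
  rw [lintegral_coinLaw, ENNReal.ofReal_add (by positivity) (by positivity),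
    ENNReal.ofReal_mul hp0, ENNReal.ofReal_mul hp1']
  gcongr

end Coin

section Compression

variable {E : Type*} [NormedAddCommGroup E] [NormedSpace ℝ E]
  {M : Type*} [TopologicalSpace M] [ChartedSpace E M]
  [RiemannianBundle (fun x : M => TangentSpace 𝓘(ℝ, E) x)]
  {S : Type*} [MeasurableSpace S]

theorem IsUnbiasedCompressor.memLp_sub {ν : Measure S} [IsFiniteMeasure ν]
    {Q : S → ∀ x : M, TangentSpace 𝓘(ℝ, E) x → TangentSpace 𝓘(ℝ, E) x} {ωQ : ℝ}
    (hQ : IsUnbiasedCompressor ν Q ωQ) (x : M) (v : TangentSpace 𝓘(ℝ, E) x) :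
    MemLp (fun s => Q s x v - v) 2 ν :=
  (memLp_two_iff_integrable_sq_norm
    ((hQ.integrable x v).sub (integrable_const v)).aestronglyMeasurable).2 (hQ.integrable_sq x v)

theorem IsUnbiasedCompressor.integral_sub_eq_zero [FiniteDimensional ℝ E] {ν : Measure S}
    [IsProbabilityMeasure ν]
    {Q : S → ∀ x : M, TangentSpace 𝓘(ℝ, E) x → TangentSpace 𝓘(ℝ, E) x} {ωQ : ℝ}
    (hQ : IsUnbiasedCompressor ν Q ωQ) (x : M) (v : TangentSpace 𝓘(ℝ, E) x) :
    ∫ s, (Q s x v - v) ∂ν = 0 := by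
  have : FiniteDimensional ℝ (TangentSpace 𝓘(ℝ, E) x) := inferInstanceAs (FiniteDimensional ℝ E)
  have : CompleteSpace (TangentSpace 𝓘(ℝ, E) x) := FiniteDimensional.complete ℝ _
  rw [integral_sub (hQ.integrable x v) (integrable_const v), hQ.unbiased x v, integral_const,
    probReal_univ, one_smul, sub_self]

theorem IsUnbiasedCompressor.integral_norm_smul_sub_sq_le {ν : Measure S}
    {Q : S → ∀ x : M, TangentSpace 𝓘(ℝ, E) x → TangentSpace 𝓘(ℝ, E) x} {ωQ : ℝ}
    (hQ : IsUnbiasedCompressor ν Q ωQ) {x : M} {v : TangentSpace 𝓘(ℝ, E) x} {D : ℝ}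
    (hv : ‖v‖ ≤ D) (a : ℝ) :
    ∫ s, ‖a • (Q s x v - v)‖ ^ 2 ∂ν ≤ a ^ 2 * (ωQ * D ^ 2) := by
  have hω : 0 ≤ ωQ := hQ.nonneg
  simp only [norm_smul, mul_pow, Real.norm_eq_abs, sq_abs]
  rw [integral_const_mul]
  gcongr
  exact (hQ.variance_le x v).trans (by gcongr)

theorem lintegral_norm_add_sum_compression_error_sq_le [FiniteDimensional ℝ E] {n : ℕ}
    {ν : Fin n → Measure S} [∀ i, IsProbabilityMeasure (ν i)]
    {Q : Fin n → S → ∀ x : M, TangentSpace 𝓘(ℝ, E) x → TangentSpace 𝓘(ℝ, E) x} {ωQ : ℝ}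
    (hQ : ∀ i, IsUnbiasedCompressor (ν i) (Q i) ωQ) {x : M} (A : TangentSpace 𝓘(ℝ, E) x)
    {d : Fin n → TangentSpace 𝓘(ℝ, E) x} {D : ℝ} (hd : ∀ i, ‖d i‖ ≤ D) :
    ∫⁻ s : Fin n → S, ENNReal.ofReal
        (‖A + ∑ i, (1 / (n : ℝ)) • (Q i (s i) x (d i) - d i)‖ ^ 2) ∂(Measure.pi ν)
      ≤ ENNReal.ofReal (‖A‖ ^ 2 + ωQ / n * D ^ 2) := by
  have : FiniteDimensional ℝ (TangentSpace 𝓘(ℝ, E) x) := inferInstanceAs (FiniteDimensional ℝ E)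
  have : CompleteSpace (TangentSpace 𝓘(ℝ, E) x) := FiniteDimensional.complete ℝ _
  let X : Fin n → S → TangentSpace 𝓘(ℝ, E) x := fun i a => (1 / (n : ℝ)) • (Q i a x (d i) - d i)
  have hX (i : Fin n) : MemLp (X i) 2 (ν i) := ((hQ i).memLp_sub x (d i)).const_smul _
  have hX0 (i : Fin n) : ∫ a, X i a ∂(ν i) = 0 := by
    rw [integral_smul, (hQ i).integral_sub_eq_zero x (d i), smul_zero]
  have hsum : MemLp (fun s : Fin n → S => A + ∑ i, X i (s i)) 2 (Measure.pi ν) :=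
    (memLp_const A).add (memLp_finsetSum _ fun i _ => memLp_comp_eval (hX i))
  have hint : Integrable (fun s : Fin n → S => ‖A + ∑ i, X i (s i)‖ ^ 2) (Measure.pi ν) :=
    (memLp_two_iff_integrable_sq_norm hsum.1).1 hsum
  rw [← ofReal_integral_eq_lintegral_ofReal hint (.of_forall fun s => by positivity)]
  refine ENNReal.ofReal_le_ofReal ?_
  calc ∫ s : Fin n → S, ‖A + ∑ i, X i (s i)‖ ^ 2 ∂(Measure.pi ν)
      = ‖A‖ ^ 2 + ∑ i, ∫ a, ‖X i a‖ ^ 2 ∂(ν i) :=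
        integral_norm_const_add_sum_comp_eval_sq hX hX0 A
    _ ≤ ‖A‖ ^ 2 + ∑ _i : Fin n, (1 / (n : ℝ)) ^ 2 * (ωQ * D ^ 2) := by
        gcongr with i
        exact (hQ i).integral_norm_smul_sub_sq_le (hd i) _
    _ = ‖A‖ ^ 2 + ωQ / n * D ^ 2 := by
        rw [Finset.sum_const, Finset.card_univ, Fintype.card_fin, nsmul_eq_mul]
        rcases eq_or_ne (n : ℝ) 0 with hn | hn
        · simp [hn]
        · field_simp

end Compression

section OneStep

theorem stepsize_quadratic_le {L η q : ℝ} (hL : 0 < L) (hη0 : 0 < η) (hq : 0 ≤ q)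
    (hη : η ≤ 1 / (L * (1 + √q))) : L * η + q * (L * η) ^ 2 ≤ 1 := by
  have hη' : L * η * (1 + √q) ≤ 1 := by
    rw [le_div_iff₀ (by positivity)] at hη
    linarith
  have hLη : 0 ≤ L * η := by positivity
  have hroot : √q * (L * η) ≤ 1 := by linarith
  calc L * η + q * (L * η) ^ 2 = L * η + (√q * (L * η)) ^ 2 := by
        rw [mul_pow √q, Real.sq_sqrt hq]
    _ ≤ L * η + √q * (L * η) := by
        gcongr
        exact pow_le_of_le_one (by positivity) hroot two_ne_zero
    _ ≤ 1 := by linarith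

theorem potential_descent_le {L η p c a b δ f₀ f₁ : ℝ} (hp : 0 < p) (hη : 0 ≤ η) (hb : 0 ≤ b)
    (hstep : L * η + (1 - p) / p * c * (L * η) ^ 2 ≤ 1)
    (hdescent : f₁ ≤ f₀ - η / 2 * (a + b - δ) + L / 2 * η ^ 2 * b) :
    p * f₁ + (1 - p) * (f₁ + η / (2 * p) * (δ + c * (L * η) ^ 2 * b)) + η / 2 * a
      ≤ f₀ + η / (2 * p) * δ := by
  have hscaled : η * b / 2 * (L * η + (1 - p) / p * c * (L * η) ^ 2) ≤ η * b / 2 * 1 := by gcongr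
  calc p * f₁ + (1 - p) * (f₁ + η / (2 * p) * (δ + c * (L * η) ^ 2 * b)) + η / 2 * a
      = f₁ + η / 2 * a + η / (2 * p) * δ - η / 2 * δ
        + η * b / 2 * ((1 - p) / p * c * (L * η) ^ 2) := by
        field_simp
        ring
    _ ≤ f₀ + η / (2 * p) * δ := by linarith

variable {E : Type*} [NormedAddCommGroup E] [NormedSpace ℝ E] [FiniteDimensional ℝ E]
  {M : Type*} [TopologicalSpace M] [ChartedSpace E M]
  [RiemannianBundle (fun x : M => TangentSpace 𝓘(ℝ, E) x)] {n : ℕ} {f : Fin n → M → ℝ}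

/-- The Lyapunov function of the method at the point `q.proj` with aggregated estimator `q.2`: the
optimality gap plus a multiple of the squared estimation error. It lives on the tangent bundle, so
that its measurability makes sense. -/
def potential (f : Fin n → M → ℝ) (fstar η p : ℝ) (q : TangentBundle 𝓘(ℝ, E) M) : ℝ :=
  objective f q.proj - fstar + η / (2 * p) * ‖q.2 - riemGrad (E := E) (objective f) q.proj‖ ^ 2

theorem potential_eq_of_snd_eq_riemGrad {fstar η p : ℝ} {q : TangentBundle 𝓘(ℝ, E) M}
    (hq : q.2 = riemGrad (objective f) q.proj) :
    potential f fstar η p q = objective f q.proj - fstar := by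
  rw [potential, hq, sub_self, norm_zero, zero_pow two_ne_zero, mul_zero, add_zero]

theorem potential_nonneg {fstar η p : ℝ} (hfstar : ∀ x, fstar ≤ objective f x) (hη : 0 ≤ η)
    (hp : 0 ≤ p) (q : TangentBundle 𝓘(ℝ, E) M) : 0 ≤ potential f fstar η p q :=
  add_nonneg (sub_nonneg.2 (hfstar _)) (by positivity)

/-- A state with the workers' estimators aggregated, as a point of the tangent bundle. -/
def State.pair (σ : State E M n) : TangentBundle 𝓘(ℝ, E) M := ⟨σ.pt, σ.avg⟩

variable {S : Type*} {Q : Fin n → S → ∀ x : M, TangentSpace 𝓘(ℝ, E) x → TangentSpace 𝓘(ℝ, E) x}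

theorem potential_marinaStep_true (hf : ∀ i, MDifferentiable 𝓘(ℝ, E) 𝓘(ℝ, ℝ) (f i))
    (fstar η p : ℝ) (σ : State E M n) (s : Fin n → S) :
    potential f fstar η p (marinaStep f Q η σ true s).pair
      = objective f (riemExp σ.pt (-(η • σ.avg))) - fstar :=
  potential_eq_of_snd_eq_riemGrad (riemGrad_objective hf _).symm

/-- The difference between the gradient of `f` at `Exp_x(v)` and the transported gradient at `x`,
which is what a worker compresses. -/
def gradDiff (f : M → ℝ) (x : M) (v : TangentSpace 𝓘(ℝ, E) x) :
    TangentSpace 𝓘(ℝ, E) (riemExp x v) :=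
  riemGrad f (riemExp x v) - expTransport x v (riemGrad f x)

variable [IsManifold 𝓘(ℝ, E) ∞ M]
  [IsContMDiffRiemannianBundle 𝓘(ℝ, E) ∞ E (fun x : M => TangentSpace 𝓘(ℝ, E) x)]

theorem avg_marinaStep_false_sub_riemGrad (hM : GeodesicallyComplete E M)
    (hf : ∀ i, MDifferentiable 𝓘(ℝ, E) 𝓘(ℝ, ℝ) (f i)) (η : ℝ) (σ : State E M n) (s : Fin n → S) :
    (marinaStep f Q η σ false s).avg - riemGrad (objective f) (marinaStep f Q η σ false s).pt
      = expTransportₗᵢ hM σ.pt (-(η • σ.avg)) (σ.avg - riemGrad (objective f) σ.pt)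
        + ∑ i, (1 / (n : ℝ)) • (Q i (s i) _ (gradDiff (f i) σ.pt (-(η • σ.avg)))
          - gradDiff (f i) σ.pt (-(η • σ.avg))) := by
  set v := -(η • σ.avg)
  have havg : (marinaStep f Q η σ false s).avg = (1 / (n : ℝ)) • ∑ i,
      (expTransportₗᵢ hM σ.pt v (σ.est i) + Q i (s i) _ (gradDiff (f i) σ.pt v)) := rfl
  have hgrad : riemGrad (objective f) (marinaStep f Q η σ false s).pt
      = (1 / (n : ℝ)) • ∑ i, riemGrad (f i) (riemExp σ.pt v) := riemGrad_objective hf _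
  have hdiff (i : Fin n) : riemGrad (f i) (riemExp σ.pt v)
      = gradDiff (f i) σ.pt v + expTransportₗᵢ hM σ.pt v (riemGrad (f i) σ.pt) :=
    (sub_add_cancel _ _).symm
  refine (congrArg₂ (fun a b : TangentSpace 𝓘(ℝ, E) (riemExp σ.pt v) => a - b) havg hgrad).trans ?_
  rw [riemGrad_objective hf σ.pt, State.avg, map_sub, map_smul, map_smul, map_sum, map_sum]
  simp only [hdiff, ← Finset.smul_sum, Finset.sum_add_distrib, Finset.sum_sub_distrib]
  module

variable {L : ℝ}

theorem objective_riemExp_le (hM : GeodesicallyComplete E M) (hn : 0 < n)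
    (hf : ∀ i, IsGSmooth E L (f i)) (x : M) (v : TangentSpace 𝓘(ℝ, E) x) :
    objective f (riemExp x v)
      ≤ objective f x + inner ℝ (riemGrad (objective f) x) v + L / 2 * ‖v‖ ^ 2 := by
  have hn' : (n : ℝ) ≠ 0 := Nat.cast_ne_zero.2 hn.ne'
  calc objective f (riemExp x v)
      ≤ 1 / (n : ℝ) * ∑ i, (f i x + inner ℝ (riemGrad (f i) x) v + L / 2 * ‖v‖ ^ 2) := by
        unfold objective
        gcongr with i
        exact (hf i).riemExp_le hM x v
    _ = objective f x + inner ℝ (riemGrad (objective f) x) v + L / 2 * ‖v‖ ^ 2 := by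
        rw [riemGrad_objective (fun i => (hf i).mdifferentiable) x, real_inner_smul_left, sum_inner]
        simp only [objective, Finset.sum_add_distrib, Finset.sum_const, Finset.card_univ,
          Fintype.card_fin, nsmul_eq_mul]
        field_simp

theorem objective_riemExp_neg_smul_le (hM : GeodesicallyComplete E M) (hn : 0 < n)
    (hf : ∀ i, IsGSmooth E L (f i)) (η : ℝ) (x : M) (g : TangentSpace 𝓘(ℝ, E) x) :
    objective f (riemExp x (-(η • g))) ≤ objective f x
      - η / 2 * (‖riemGrad (E := E) (objective f) x‖ ^ 2 + ‖g‖ ^ 2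
        - ‖g - riemGrad (objective f) x‖ ^ 2) + L / 2 * η ^ 2 * ‖g‖ ^ 2 := by
  refine (objective_riemExp_le hM hn hf x (-(η • g))).trans_eq ?_
  rw [norm_sub_sq_real, real_inner_comm, inner_neg_left, real_inner_smul_left, norm_neg, norm_smul,
    mul_pow, Real.norm_eq_abs, sq_abs]
  ring

variable [MeasurableSpace S] {ν : Fin n → Measure S} [∀ i, IsProbabilityMeasure (ν i)] {ωQ : ℝ}
  {fstar η p : ℝ}

theorem lintegral_norm_avg_marinaStep_false_sub_sq_le (hM : GeodesicallyComplete E M)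
    (hf : ∀ i, IsGSmooth E L (f i)) (hQ : ∀ i, IsUnbiasedCompressor (ν i) (Q i) ωQ)
    (σ : State E M n) :
    ∫⁻ s, ENNReal.ofReal (‖(marinaStep f Q η σ false s).avg
        - riemGrad (objective f) (marinaStep f Q η σ false s).pt‖ ^ 2) ∂(Measure.pi ν)
      ≤ ENNReal.ofReal (‖σ.avg - riemGrad (objective f) σ.pt‖ ^ 2
          + ωQ / n * (L * η) ^ 2 * ‖σ.avg‖ ^ 2) := by
  have hdiff (i : Fin n) : ‖gradDiff (f i) σ.pt (-(η • σ.avg))‖ ≤ L * ‖η • σ.avg‖ := by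
    rw [← norm_neg (η • σ.avg)]
    exact (hf i).norm_riemGrad_riemExp_sub_le hM σ.pt _
  calc ∫⁻ s, ENNReal.ofReal (‖(marinaStep f Q η σ false s).avg
        - riemGrad (objective f) (marinaStep f Q η σ false s).pt‖ ^ 2) ∂(Measure.pi ν)
      = _ := lintegral_congr fun s =>
        congrArg (fun w : TangentSpace 𝓘(ℝ, E) (riemExp σ.pt (-(η • σ.avg))) =>
          ENNReal.ofReal (‖w‖ ^ 2))
          (avg_marinaStep_false_sub_riemGrad hM (fun i => (hf i).mdifferentiable) η σ s)
    _ ≤ _ := lintegral_norm_add_sum_compression_error_sq_le hQ _ hdiff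
    _ = _ := by
        rw [LinearIsometry.norm_map, norm_smul, Real.norm_eq_abs, mul_pow L, mul_pow |η|, sq_abs]
        ring_nf

theorem lintegral_potential_marinaStep_false_le (hM : GeodesicallyComplete E M)
    (hf : ∀ i, IsGSmooth E L (f i)) (hQ : ∀ i, IsUnbiasedCompressor (ν i) (Q i) ωQ)
    (hω : 0 ≤ ωQ) (hfstar : ∀ x, fstar ≤ objective f x) (hη : 0 ≤ η) (hp : 0 ≤ p)
    (σ : State E M n) :
    ∫⁻ s, ENNReal.ofReal (potential f fstar η p (marinaStep f Q η σ false s).pair) ∂(Measure.pi ν)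
      ≤ ENNReal.ofReal (objective f (riemExp σ.pt (-(η • σ.avg))) - fstar
        + η / (2 * p) * (‖σ.avg - riemGrad (objective f) σ.pt‖ ^ 2
          + ωQ / n * (L * η) ^ 2 * ‖σ.avg‖ ^ 2)) := by
  have hgap : 0 ≤ objective f (riemExp σ.pt (-(η • σ.avg))) - fstar := sub_nonneg.2 (hfstar _)
  have hpot (s : Fin n → S) :
      ENNReal.ofReal (potential f fstar η p (marinaStep f Q η σ false s).pair)
        = ENNReal.ofReal (objective f (riemExp σ.pt (-(η • σ.avg))) - fstar)
          + ENNReal.ofReal (η / (2 * p)) *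
            ENNReal.ofReal (‖(marinaStep f Q η σ false s).avg
              - riemGrad (objective f) (marinaStep f Q η σ false s).pt‖ ^ 2) := by
    rw [← ENNReal.ofReal_mul (by positivity), ← ENNReal.ofReal_add hgap (by positivity)]
    rfl
  simp only [hpot]
  rw [lintegral_add_left measurable_const, lintegral_const, measure_univ, mul_one,
    lintegral_const_mul' _ _ ENNReal.ofReal_ne_top, ENNReal.ofReal_add hgap (by positivity),
    ENNReal.ofReal_mul (by positivity)]
  gcongr
  exact lintegral_norm_avg_marinaStep_false_sub_sq_le hM hf hQ σ

theorem lintegral_potential_marinaStep_le (hM : GeodesicallyComplete E M) (hn : 0 < n) (hL : 0 < L)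
    (hf : ∀ i, IsGSmooth E L (f i)) (hfstar : ∀ x, fstar ≤ objective f x)
    (hQ : ∀ i, IsUnbiasedCompressor (ν i) (Q i) ωQ) (hp0 : 0 < p) (hp1 : p ≤ 1) (hη0 : 0 < η)
    (hη : η ≤ 1 / (L * (1 + √((1 - p) / p * (ωQ / n))))) (σ : State E M n) :
    ∫⁻ r, ENNReal.ofReal (potential f fstar η p (marinaStep f Q η σ r.1 r.2).pair)
        ∂((coinLaw p).prod (Measure.pi ν))
      + ENNReal.ofReal (η / 2 * ‖riemGrad (E := E) (objective f) σ.pt‖ ^ 2)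
      ≤ ENNReal.ofReal (potential f fstar η p σ.pair) := by
  have hω : 0 ≤ ωQ := (hQ ⟨0, hn⟩).nonneg
  have : 0 ≤ 1 - p := sub_nonneg.2 hp1
  have hgap : 0 ≤ objective f (riemExp σ.pt (-(η • σ.avg))) - fstar := sub_nonneg.2 (hfstar _)
  have hdescent := objective_riemExp_neg_smul_le hM hn hf η σ.pt σ.avg
  have htrue : ∫⁻ s, ENNReal.ofReal (potential f fstar η p (marinaStep f Q η σ true s).pair)
      ∂(Measure.pi ν) ≤ ENNReal.ofReal (objective f (riemExp σ.pt (-(η • σ.avg))) - fstar) := by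
    simp only [potential_marinaStep_true fun i => (hf i).mdifferentiable, lintegral_const,
      measure_univ, mul_one, le_refl]
  have hfalse := lintegral_potential_marinaStep_false_le hM hf hQ hω hfstar hη0.le hp0.le σ
  refine (add_le_add_left
    (lintegral_coinLaw_prod_le hp0.le hp1 hgap (by positivity) htrue hfalse) _).trans ?_
  rw [← ENNReal.ofReal_add (by positivity) (by positivity)]
  refine ENNReal.ofReal_le_ofReal (potential_descent_le hp0 hη0.le (by positivity)
    (stepsize_quadratic_le hL hη0 (by positivity) hη) ?_)
  change _ ≤ objective f σ.pt - fstar - _ + _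
  linarith

end OneStep

section RandomInputs

open scoped ENNReal

variable {Ω : Type*} [MeasurableSpace Ω] {P : Measure Ω} {X Y : Type*} [MeasurableSpace X]
  [MeasurableSpace Y]

theorem lintegral_prodMk_of_indepFun [IsFiniteMeasure P] {Z : Ω → X} {W : Ω → Y}
    (hZ : Measurable Z) (hW : Measurable W) (hZW : IndepFun Z W P) {g : X × Y → ℝ≥0∞}
    (hg : Measurable g) :
    ∫⁻ a, g (Z a, W a) ∂P = ∫⁻ a, ∫⁻ y, g (Z a, y) ∂(P.map W) ∂P := by
  rw [← lintegral_map hg (hZ.prodMk hW),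
    hZW.map_prod_eq_prod_map_map hZ.aemeasurable hW.aemeasurable,
    lintegral_prod _ hg.aemeasurable, lintegral_map hg.lintegral_prod_right' hZ]

theorem indepFun_past_present {ζ : ℕ → Ω → X} (hζ : ∀ k, Measurable (ζ k)) (hζP : iIndepFun ζ P)
    (k : ℕ) (x₀ : X) :
    IndepFun (fun a j => if j < k then ζ j a else x₀) (ζ k) P := by
  have hrestrict := hζP.indepFun_finset (Finset.range k) {k} (by simp) hζ
  have hextend : Measurable fun (z : Finset.range k → X) (j : ℕ) =>
      if h : j < k then z ⟨j, Finset.mem_range.2 h⟩ else x₀ := by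
    refine measurable_pi_lambda _ fun j => ?_
    split_ifs
    · exact measurable_pi_apply _
    · exact measurable_const
  exact hrestrict.comp hextend
    (measurable_pi_apply (⟨k, Finset.mem_singleton_self k⟩ : ({k} : Finset ℕ)))

theorem lintegral_eq_lintegral_update [IsProbabilityMeasure P] {ζ : ℕ → Ω → X}
    (hζ : ∀ k, Measurable (ζ k)) (hζP : iIndepFun ζ P) {k : ℕ} {F : (ℕ → X) → ℝ≥0∞}
    (hF : Measurable F) (hFk : DependsOn F (Set.Iio (k + 1))) :
    ∫⁻ a, F (fun j => ζ j a) ∂P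
      = ∫⁻ a, ∫⁻ x, F (Function.update (fun j => ζ j a) k x) ∂(P.map (ζ k)) ∂P := by
  obtain ⟨a₀⟩ := nonempty_of_isProbabilityMeasure P
  set past : Ω → ℕ → X := fun a j => if j < k then ζ j a else ζ k a₀
  have hpast : Measurable past := by
    refine measurable_pi_lambda _ fun j => ?_
    by_cases hj : j < k <;> simp [past, hj, hζ j]
  have hupdate (a : Ω) (x : X) :
      F (Function.update (past a) k x) = F (Function.update (fun j => ζ j a) k x) :=
    hFk fun j hj => by
      rcases (Nat.lt_succ_iff_lt_or_eq.1 hj) with hlt | rfl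
      · simp [past, hlt, hlt.ne]
      · simp
  have hpresent := lintegral_prodMk_of_indepFun hpast (hζ k)
    (indepFun_past_present hζ hζP k (ζ k a₀)) (hF.comp (measurable_update' (a := k)))
  have hself (a : Ω) : Function.update (fun j => ζ j a) k (ζ k a) = fun j => ζ j a :=
    Function.update_eq_self k _
  simpa only [Function.comp_apply, hupdate, hself] using hpresent

variable {K : ℕ} {κ : Ω → Fin K} {Z : Ω → X}

theorem lintegral_uniform_index [IsFiniteMeasure P] (hκ : Measurable κ)
    (hκP : ∀ j, P (κ ⁻¹' {j}) = (K : ℝ≥0∞)⁻¹) (hZ : Measurable Z) (hκZ : IndepFun κ Z P)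
    {g : Fin K → X → ℝ≥0∞} (hg : ∀ j, Measurable (g j)) :
    ∫⁻ a, g (κ a) (Z a) ∂P = (K : ℝ≥0∞)⁻¹ * ∑ j, ∫⁻ a, g j (Z a) ∂P := by
  have hgZ (j : Fin K) : Measurable fun a => g j (Z a) := (hg j).comp hZ
  rw [lintegral_prodMk_of_indepFun (g := fun q : X × Fin K => g q.2 q.1) hZ hκ hκZ.symm
    (measurable_from_prod_countable_left hg)]
  simp only [lintegral_fintype, Measure.map_apply hκ (measurableSet_singleton _), hκP]
  rw [lintegral_finsetSum _ fun j _ => (hgZ j).mul_const _, Finset.mul_sum]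
  simp only [lintegral_mul_const _ (hgZ _), mul_comm]

theorem integrable_and_integral_uniform_index_le [IsFiniteMeasure P] (hK : 0 < K)
    (hκ : Measurable κ) (hκP : ∀ j, P (κ ⁻¹' {j}) = (K : ℝ≥0∞)⁻¹) (hZ : Measurable Z)
    (hκZ : IndepFun κ Z P) {g : Fin K → X → ℝ} (hg : ∀ j, Measurable (g j))
    (hg0 : ∀ j x, 0 ≤ g j x) {B : ℝ} (hB : 0 ≤ B)
    (hsum : ∑ j, ∫⁻ a, ENNReal.ofReal (g j (Z a)) ∂P ≤ ENNReal.ofReal B) :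
    Integrable (fun a => g (κ a) (Z a)) P ∧ ∫ a, g (κ a) (Z a) ∂P ≤ B / K := by
  have hK' : (0 : ℝ) < K := Nat.cast_pos.2 hK
  have hmeas : Measurable fun a => g (κ a) (Z a) :=
    (measurable_from_prod_countable_right (f := fun q : Fin K × X => g q.1 q.2) hg).comp
      (hκ.prodMk hZ)
  have hnonneg : 0 ≤ᵐ[P] fun a => g (κ a) (Z a) := .of_forall fun a => hg0 _ _
  have hlintegral : ∫⁻ a, ENNReal.ofReal (g (κ a) (Z a)) ∂P ≤ ENNReal.ofReal (B / K) := by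
    rw [lintegral_uniform_index (g := fun j x => ENNReal.ofReal (g j x)) hκ hκP hZ hκZ
      fun j => (hg j).ennreal_ofReal, div_eq_inv_mul, ENNReal.ofReal_mul (by positivity),
      ENNReal.ofReal_inv_of_pos hK', ENNReal.ofReal_natCast]
    gcongr
  refine ⟨(lintegral_ofReal_ne_top_iff_integrable hmeas.aestronglyMeasurable hnonneg).1
    (hlintegral.trans_lt ENNReal.ofReal_lt_top).ne, ?_⟩
  rw [integral_eq_lintegral_of_nonneg_ae hnonneg hmeas.aestronglyMeasurable]
  exact ENNReal.toReal_le_of_le_ofReal (by positivity) hlintegral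

end RandomInputs

theorem sum_range_add_le_of_add_le {R : Type*} [AddCommMonoid R] [Preorder R] [AddLeftMono R]
    {a b : ℕ → R} (h : ∀ k, b k + a (k + 1) ≤ a k) (K : ℕ) :
    ∑ k ∈ Finset.range K, b k + a K ≤ a 0 := by
  induction K with
  | zero => simp
  | succ K ih =>
    rw [Finset.sum_range_succ, add_assoc]
    exact (add_le_add_right (h K) _).trans ih

section Run

variable {E : Type*} [NormedAddCommGroup E] [NormedSpace ℝ E] [FiniteDimensional ℝ E]
  {M : Type*} [TopologicalSpace M] [ChartedSpace E M]
  [RiemannianBundle (fun x : M => TangentSpace 𝓘(ℝ, E) x)]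
  {S : Type*} {n : ℕ} {f : Fin n → M → ℝ}
  {Q : Fin n → S → ∀ x : M, TangentSpace 𝓘(ℝ, E) x → TangentSpace 𝓘(ℝ, E) x}
  {σ₀ : State E M n} {L ωQ fstar η p : ℝ}

theorem dependsOn_marina (k : ℕ) :
    DependsOn (fun r => marina f Q η σ₀ r k) (Set.Iio k) := by
  induction k with
  | zero => exact fun _ _ _ => rfl
  | succ k ih =>
    intro r r' h
    have hk : r k = r' k := h k k.lt_succ_self
    have hmarina : marina f Q η σ₀ r k = marina f Q η σ₀ r' k :=
      ih fun j hj => h j (Nat.lt_succ_of_lt hj)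
    simp only [marina, hk, hmarina]

theorem marina_update_succ (r : ℕ → Bool × (Fin n → S)) (k : ℕ) (s : Bool × (Fin n → S)) :
    marina f Q η σ₀ (Function.update r k s) (k + 1)
      = marinaStep f Q η (marina f Q η σ₀ r k) s.1 s.2 := by
  have hmarina : marina f Q η σ₀ (Function.update r k s) k = marina f Q η σ₀ r k :=
    dependsOn_marina k fun j hj => Function.update_of_ne (ne_of_lt (Set.mem_Iio.1 hj)) s r
  simp only [marina, hmarina, Function.update_self]

variable [SecondCountableTopology M] [IsManifold 𝓘(ℝ, E) ∞ M]
  [IsContMDiffRiemannianBundle 𝓘(ℝ, E) ∞ E (fun x : M => TangentSpace 𝓘(ℝ, E) x)]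

theorem measurable_potential (hf : ∀ i, MDifferentiable 𝓘(ℝ, E) 𝓘(ℝ, ℝ) (f i)) :
    Measurable[borel (TangentBundle 𝓘(ℝ, E) M)] (potential f fstar η p) := by
  have hobj := mdifferentiable_objective hf
  borelize (TangentBundle 𝓘(ℝ, E) M)
  exact ((hobj.continuous.comp continuous_tangentBundle_proj).measurable.sub_const fstar).add
    ((measurable_norm_sub_riemGrad_sq hobj).const_mul _)

theorem measurable_norm_riemGrad_sq_pt {X : Type*} [MeasurableSpace X] {σ : X → State E M n}
    (hσ : Measurable[_, borel (TangentBundle 𝓘(ℝ, E) M)] fun x => (σ x).pair) {g : M → ℝ}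
    (hg : MDifferentiable 𝓘(ℝ, E) 𝓘(ℝ, ℝ) g) :
    Measurable fun x => ‖riemGrad (E := E) g (σ x).pt‖ ^ 2 := by
  borelize (TangentBundle 𝓘(ℝ, E) M) M
  exact (measurable_norm_riemGrad_sq hg).comp (continuous_tangentBundle_proj.measurable.comp hσ)

variable [MeasurableSpace S] {ν : Fin n → Measure S} [∀ i, IsProbabilityMeasure (ν i)]
  {Ω : Type*} [MeasurableSpace Ω] {P : Measure Ω} [IsProbabilityMeasure P]
  {ζ : ℕ → Ω → Bool × (Fin n → S)}

theorem lintegral_potential_marina_succ_le (hM : GeodesicallyComplete E M) (hn : 0 < n)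
    (hL : 0 < L) (hf : ∀ i, IsGSmooth E L (f i)) (hfstar : ∀ x, fstar ≤ objective f x)
    (hQ : ∀ i, IsUnbiasedCompressor (ν i) (Q i) ωQ) (hp0 : 0 < p) (hp1 : p ≤ 1) (hη0 : 0 < η)
    (hη : η ≤ 1 / (L * (1 + √((1 - p) / p * (ωQ / n)))))
    (hmeas : ∀ k, Measurable[MeasurableSpace.pi, borel (TangentBundle 𝓘(ℝ, E) M)]
      fun r => (marina f Q η σ₀ r k).pair)
    (hζ : ∀ k, Measurable (ζ k)) (hζlaw : ∀ k, HasLaw (ζ k) ((coinLaw p).prod (Measure.pi ν)) P)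
    (hζP : iIndepFun ζ P) (k : ℕ) :
    ∫⁻ a, ENNReal.ofReal (η / 2 * ‖riemGrad (E := E) (objective f)
        (marina f Q η σ₀ (fun j => ζ j a) k).pt‖ ^ 2) ∂P
      + ∫⁻ a, ENNReal.ofReal
          (potential f fstar η p (marina f Q η σ₀ (fun j => ζ j a) (k + 1)).pair) ∂P
      ≤ ∫⁻ a, ENNReal.ofReal
          (potential f fstar η p (marina f Q η σ₀ (fun j => ζ j a) k).pair) ∂P := by
  have hfi (i : Fin n) := (hf i).mdifferentiable
  have hgrad : Measurable fun a => ENNReal.ofReal (η / 2 * ‖riemGrad (E := E) (objective f)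
      (marina f Q η σ₀ (fun j => ζ j a) k).pt‖ ^ 2) :=
    ((measurable_norm_riemGrad_sq_pt ((hmeas k).comp (measurable_pi_lambda _ hζ))
      (mdifferentiable_objective hfi)).const_mul _).ennreal_ofReal
  have hfresh := lintegral_eq_lintegral_update hζ hζP (k := k)
    ((measurable_potential (fstar := fstar) (η := η) (p := p) hfi).comp
      (hmeas (k + 1))).ennreal_ofReal
    fun r r' h => by simp only [Function.comp_apply, dependsOn_marina (k + 1) h]
  simp only [Function.comp_apply] at hfresh
  rw [hfresh, ← lintegral_add_left hgrad]
  refine lintegral_mono fun a => ?_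
  simp only [marina_update_succ, (hζlaw k).map_eq]
  rw [add_comm]
  exact lintegral_potential_marinaStep_le hM hn hL hf hfstar hQ hp0 hp1 hη0 hη _

theorem sum_lintegral_norm_riemGrad_sq_le (hM : GeodesicallyComplete E M) (hn : 0 < n)
    (hL : 0 < L) (hf : ∀ i, IsGSmooth E L (f i)) (hfstar : ∀ x, fstar ≤ objective f x)
    (hQ : ∀ i, IsUnbiasedCompressor (ν i) (Q i) ωQ) (hp0 : 0 < p) (hp1 : p ≤ 1) (hη0 : 0 < η)
    (hη : η ≤ 1 / (L * (1 + √((1 - p) / p * (ωQ / n)))))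
    (hmeas : ∀ k, Measurable[MeasurableSpace.pi, borel (TangentBundle 𝓘(ℝ, E) M)]
      fun r => (marina f Q η σ₀ r k).pair)
    (hζ : ∀ k, Measurable (ζ k)) (hζlaw : ∀ k, HasLaw (ζ k) ((coinLaw p).prod (Measure.pi ν)) P)
    (hζP : iIndepFun ζ P) (K : ℕ) :
    ∑ k ∈ Finset.range K, ∫⁻ a, ENNReal.ofReal (η / 2 * ‖riemGrad (E := E) (objective f)
        (marina f Q η σ₀ (fun j => ζ j a) k).pt‖ ^ 2) ∂P
      ≤ ENNReal.ofReal (potential f fstar η p σ₀.pair) := by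
  have htelescope := sum_range_add_le_of_add_le
    (a := fun k => ∫⁻ a, ENNReal.ofReal
      (potential f fstar η p (marina f Q η σ₀ (fun j => ζ j a) k).pair) ∂P)
    (lintegral_potential_marina_succ_le hM hn hL hf hfstar hQ hp0 hp1 hη0 hη hmeas hζ hζlaw hζP) K
  simpa only [marina, lintegral_const, measure_univ, mul_one] using le_self_add.trans htelescope

end Run

end

end RMarina

theorem theorem5_general
    {E : Type*} [NormedAddCommGroup E] [NormedSpace ℝ E] [FiniteDimensional ℝ E]
    {M : Type*} [TopologicalSpace M] [SecondCountableTopology M]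
    [ChartedSpace E M] [IsManifold 𝓘(ℝ, E) ∞ M]
    [RiemannianBundle (fun x : M => TangentSpace 𝓘(ℝ, E) x)]
    [IsContMDiffRiemannianBundle 𝓘(ℝ, E) ∞ E (fun x : M => TangentSpace 𝓘(ℝ, E) x)]
    (hM : RMarina.GeodesicallyComplete E M)
    {n : ℕ} (hn : 0 < n) (f : Fin n → M → ℝ)
    {L : ℝ} (hL : 0 < L) (hf : ∀ i, RMarina.IsGSmooth E L (f i))
    {fstar : ℝ} (hfstar : ∀ x, fstar ≤ RMarina.objective f x)
    {S : Type*} [MeasurableSpace S] (ν : Fin n → Measure S) [∀ i, IsProbabilityMeasure (ν i)]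
    (Q : Fin n → S → ∀ x : M, TangentSpace 𝓘(ℝ, E) x → TangentSpace 𝓘(ℝ, E) x)
    {ωQ : ℝ} (hQ : ∀ i, RMarina.IsUnbiasedCompressor (ν i) (Q i) ωQ)
    {p : ℝ} (hp0 : 0 < p) (hp1 : p ≤ 1) {η : ℝ} (hη0 : 0 < η)
    (hη : η ≤ 1 / (L * (1 + √((1 - p) / p * (ωQ / n)))))
    (σ₀ : RMarina.State E M n)
    (hmeas : ∀ k, Measurable[MeasurableSpace.pi, borel (TangentBundle 𝓘(ℝ, E) M)]
      (fun r : ℕ → Bool × (Fin n → S) => (RMarina.marina f Q η σ₀ r k).pair))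
    {Ω : Type*} [MeasurableSpace Ω] (P : Measure Ω) [IsProbabilityMeasure P]
    (ζ : ℕ → Ω → Bool × (Fin n → S))
    (hζ : ∀ k, Measurable (ζ k))
    (hζlaw : ∀ k, HasLaw (ζ k) ((RMarina.coinLaw p).prod (Measure.pi ν)) P)
    (hζindep : iIndepFun ζ P)
    {K : ℕ} (κ : Ω → Fin K) (hκ : Measurable κ)
    (hκunif : ∀ j, P (κ ⁻¹' {j}) = (K : ENNReal)⁻¹)
    (hκindep : IndepFun κ (fun a k => ζ k a) P) :
    Integrable (fun a => ‖RMarina.riemGrad (E := E) (RMarina.objective f)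
      (RMarina.marina f Q η σ₀ (fun k => ζ k a) (κ a)).pt‖ ^ 2) P ∧
    ∫ a, ‖RMarina.riemGrad (E := E) (RMarina.objective f)
      (RMarina.marina f Q η σ₀ (fun k => ζ k a) (κ a)).pt‖ ^ 2 ∂P
      ≤ 2 * RMarina.potential f fstar η p σ₀.pair / (η * K) := by
  have hK : 0 < K := (κ (Classical.choice (nonempty_of_isProbabilityMeasure P))).pos
  have hobj := RMarina.mdifferentiable_objective fun i => (hf i).mdifferentiable
  have hsum := RMarina.sum_lintegral_norm_riemGrad_sq_le hM hn hL hf hfstar hQ hp0 hp1 hη0 hη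
    hmeas hζ hζlaw hζindep K
  rw [← Fin.sum_univ_eq_sum_range] at hsum
  obtain ⟨hint, hle⟩ := RMarina.integrable_and_integral_uniform_index_le
    (g := fun j r => η / 2 * ‖RMarina.riemGrad (E := E) (RMarina.objective f)
      (RMarina.marina f Q η σ₀ r j).pt‖ ^ 2)
    hK hκ hκunif (measurable_pi_lambda _ hζ) hκindep
    (fun j => (RMarina.measurable_norm_riemGrad_sq_pt (hmeas j) hobj).const_mul _)
    (fun _ _ => by positivity) (RMarina.potential_nonneg hfstar hη0.le hp0.le _) hsum
  rw [integral_const_mul] at hle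
  refine ⟨(integrable_const_mul_iff (isUnit_iff_ne_zero.2 (by positivity)) _).1 hint, ?_⟩
  have hK' : (0 : ℝ) < K := Nat.cast_pos.2 hK
  rw [le_div_iff₀ (by positivity)] at hle ⊢
  linarith

theorem theorem5
    {E : Type*} [NormedAddCommGroup E] [NormedSpace ℝ E] [FiniteDimensional ℝ E]
    {M : Type*} [TopologicalSpace M] [T2Space M] [SecondCountableTopology M]
    [ChartedSpace E M] [IsManifold 𝓘(ℝ, E) ∞ M]
    [RiemannianBundle (fun x : M => TangentSpace 𝓘(ℝ, E) x)]
    [IsContMDiffRiemannianBundle 𝓘(ℝ, E) ∞ E (fun x : M => TangentSpace 𝓘(ℝ, E) x)]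
    (hM : RMarina.GeodesicallyComplete E M)
    -- the objective
    {n : ℕ} (hn : 0 < n) (f : Fin n → M → ℝ)
    {L : ℝ} (hL : 0 < L) (hf : ∀ i, RMarina.IsGSmooth E L (f i))
    {fstar : ℝ} (hfstar : ∀ x, fstar ≤ RMarina.objective f x)
    -- the compressors
    {S : Type*} [MeasurableSpace S] (ν : Fin n → Measure S) [∀ i, IsProbabilityMeasure (ν i)]
    (Q : Fin n → S → ∀ x : M, TangentSpace 𝓘(ℝ, E) x → TangentSpace 𝓘(ℝ, E) x)
    {ωQ : ℝ} (hQ : ∀ i, RMarina.IsUnbiasedCompressor (ν i) (Q i) ωQ)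
    -- the parameters
    {p : ℝ} (hp0 : 0 < p) (hp1 : p ≤ 1) {η : ℝ} (hη0 : 0 < η)
    (hη : η ≤ 1 / (L * (1 + √((1 - p) / p * (ωQ / n)))))
    -- the initial state
    (σ₀ : RMarina.State E M n)
    (hσ₀ : σ₀.avg = RMarina.riemGrad (RMarina.objective f) σ₀.pt)
    -- the pairs `(x^k, g^k)` are measurable functions of the random inputs
    (hmeas : ∀ k, Measurable[MeasurableSpace.pi, borel (TangentBundle 𝓘(ℝ, E) M)]
      (fun r : ℕ → Bool × (Fin n → S) =>
        (⟨(RMarina.marina f Q η σ₀ r k).pt, (RMarina.marina f Q η σ₀ r k).avg⟩ :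
          TangentBundle 𝓘(ℝ, E) M)))
    -- the random inputs, independent over the iterations
    {Ω : Type*} [MeasurableSpace Ω] (P : Measure Ω) [IsProbabilityMeasure P]
    (ζ : ℕ → Ω → Bool × (Fin n → S))
    (hζ : ∀ k, Measurable (ζ k))
    (hζlaw : ∀ k, HasLaw (ζ k) ((RMarina.coinLaw p).prod (Measure.pi ν)) P)
    (hζindep : iIndepFun ζ P)
    -- the uniformly random output index, independent of the run
    {K : ℕ} (κ : Ω → Fin K) (hκ : Measurable κ)
    (hκunif : ∀ j, P (κ ⁻¹' {j}) = (K : ENNReal)⁻¹)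
    (hκindep : IndepFun κ (fun a k => ζ k a) P) :
    Integrable (fun a => ‖RMarina.riemGrad (E := E) (RMarina.objective f)
      (RMarina.marina f Q η σ₀ (fun k => ζ k a) (κ a)).pt‖ ^ 2) P ∧
    ∫ a, ‖RMarina.riemGrad (E := E) (RMarina.objective f)
      (RMarina.marina f Q η σ₀ (fun k => ζ k a) (κ a)).pt‖ ^ 2 ∂P
      ≤ 2 * (RMarina.objective f σ₀.pt - fstar) / (η * K) := by
  have hinit : RMarina.potential f fstar η p σ₀.pair = RMarina.objective f σ₀.pt - fstar :=
    RMarina.potential_eq_of_snd_eq_riemGrad hσ₀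
  exact hinit ▸ theorem5_general hM hn f hL hf hfstar ν Q hQ hp0 hp1 hη0 hη σ₀ hmeas P ζ hζ hζlaw
    hζindep κ hκ hκunif hκindep
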